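/- Let $a,b$ be real numbers with $b>0$, $a\sqrt2>b+2$, $b<\frac{a^2-1}{2a+1}$, $2a+b<4$, and let $L(x,y)=(1+y-a|x|,\,bx)$ be the Lozi map, a homeomorphism of $\mathbb R^2$. Let $X=\left(\frac1{1+a-b},\frac b{1+a-b}\right)$ be its fixed point in the first quadrant, $Z=\left(\frac{2+a+\sqrt{a^2+4b}}{2(1+a-b)},0\right)$, $\Delta$ the triangle with vertices $Z,L(Z),L^2(Z)$, and $\Lambda=\bigcap_{n\ge0}L^n(\Delta)$. For a point $P$ write $L^n(P)=(P^n_x,P^n_y)$, $n\in\mathbb Z$. A sequence $\bar p=(p_n)_{n\in\mathbb Z}\in\{-,+\}^{\mathbb Z}$ is an itinerary of $P$ if for all $n$: $P^n_x\ge0$ when $p_n=+$, and $P^n_x\le0$ when $p_n=-$. Let $\Sigma_\Lambda$ be the set of all itineraries of points of $\Lambda$, with the topology induced from the product topology on $\{-,+\}^{\mathbb Z}$. Each $\bar p\in\Sigma_\Lambda$ is an itinerary of exactly one point of $\Lambda$, denoted $\pi(\bar p)$. Let $R=\{P: L^{-n}(P)\to X \text{ as } n\to\infty\}$ be the unstable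 manifold of $X$. It is the image of the real line under a continuous one-to-one map; for $P\in R$ and $\varepsilon>0$ let $(P-\varepsilon,P+\varepsilon)$ be the set of $Q\in R$ for which the arc of $R$ from $P$ to $Q$ has length less than $\varepsilon$. An itinerary $\bar p$ of a point $P\in R$ is an essential $R$-itinerary if, for every $l\in\mathbb Z$ such that $P^l_x=0$ and $P^k_x=0$ for some $k<l$, there is $\varepsilon>0$ such that for all $Q\in(P-\varepsilon,P+\varepsilon)\setminus\{P\}$ one has $Q^l_x>0$ if $p_l=+$, and $Q^l_x<0$ if $p_l=-$. Let $\Sigma^e_\Lambda$ be the closure in $\{-,+\}^{\mathbb Z}$ of the set of all essential $R$-itineraries. Then $\Sigma^e_\Lambda\subseteq\Sigma_\Lambda$ and $\pi(\Sigma^e_\Lambda)=\Lambda$. Moreover, every compact $\Xi\subseteq\Sigma_\Lambda$ with $\pi(\Xi)=\Lambda$ contains $\Sigma^e_\Lambda$. -/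

import Mathlib

open Filter Topology

noncomputable section

namespace Lozi

/-- The Lozi map `L (x, y) = (1 + y - a|x|, b x)`, as a bijection of the plane. Integer powers of
it (in the group of permutations of the plane) are the forward and backward iterates. -/
def lozi (a b : ℝ) (hb : 0 < b) : Equiv.Perm (ℝ × ℝ) where
  toFun P := (1 + P.2 - a * |P.1|, b * P.1)
  invFun P := (P.2 / b, P.1 - 1 + a * |P.2 / b|)
  left_inv P := by
    have hb' : b ≠ 0 := hb.ne'
    have h : b * P.1 / b = P.1 := by field_simp
    ext <;> simp only [h]
    ring
  right_inv P := by
    have hb' : b ≠ 0 := hb.ne'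
    ext
    · simp only
      ring
    · simp only
      field_simp

/-- The fixed point `X` of the Lozi map in the first quadrant. -/
def fixedX (a b : ℝ) : ℝ × ℝ := (1 / (1 + a - b), b / (1 + a - b))

/-- The point `Z` on the horizontal axis. -/
def pointZ (a b : ℝ) : ℝ × ℝ := ((2 + a + √(a ^ 2 + 4 * b)) / (2 * (1 + a - b)), 0)

/-- The triangle `Δ` with vertices `Z`, `L Z`, `L² Z`. -/
def triangle (a b : ℝ) (hb : 0 < b) : Set (ℝ × ℝ) :=
  convexHull ℝ {pointZ a b, lozi a b hb (pointZ a b), lozi a b hb (lozi a b hb (pointZ a b))}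

/-- The attractor `Λ = ⋂ n ≥ 0, Lⁿ(Δ)`. -/
def attractor (a b : ℝ) (hb : 0 < b) : Set (ℝ × ℝ) :=
  ⋂ n : ℕ, (lozi a b hb ^ n) '' triangle a b hb

/-- `p` is an itinerary of the point `P`; the symbol `+` is `true`, the symbol `-` is `false`.
Both symbols are allowed at a time `n` at which the orbit is on the vertical axis. -/
def IsItinerary (a b : ℝ) (hb : 0 < b) (P : ℝ × ℝ) (p : ℤ → Bool) : Prop :=
  ∀ n : ℤ, (p n = true → 0 ≤ ((lozi a b hb ^ n) P).1) ∧
    (p n = false → ((lozi a b hb ^ n) P).1 ≤ 0)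

/-- The set `Σ_Λ` of admissible sequences. -/
def admissible (a b : ℝ) (hb : 0 < b) : Set (ℤ → Bool) :=
  {p | ∃ P ∈ attractor a b hb, IsItinerary a b hb P p}

/-- The map `π`: the point of the attractor that has itinerary `p`
(an arbitrary point if `p` is not admissible). -/
def coding (a b : ℝ) (hb : 0 < b) (p : ℤ → Bool) : ℝ × ℝ :=
  Classical.epsilon fun P => P ∈ attractor a b hb ∧ IsItinerary a b hb P p

/-- `R`, the unstable manifold of the fixed point `X`. -/
def unstableX (a b : ℝ) (hb : 0 < b) : Set (ℝ × ℝ) :=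
  {P | Tendsto (fun n : ℕ => ((lozi a b hb)⁻¹ ^ n) P) atTop (𝓝 (fixedX a b))}

/-- The eigenvalue `μ < -1` of the derivative of `L` at `X`; an eigenvector is `(μ, b)`. -/
def unstableEigenvalue (a b : ℝ) : ℝ := (-a - √(a ^ 2 + 4 * b)) / 2

/-- The continuous one-to-one map from the real line onto `R` that conjugates `t ↦ μ t` to `L`.
Near `0` it is `t ↦ X + t (μ, b)`; the sequence below is eventually constant, because `L` is
affine near `X`. -/
def unstableCurve (a b : ℝ) (hb : 0 < b) (t : ℝ) : ℝ × ℝ :=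
  limUnder atTop fun n : ℕ =>
    (lozi a b hb ^ n) (fixedX a b + (t / unstableEigenvalue a b ^ n) • (unstableEigenvalue a b, b))

/-- The (Euclidean) length of the arc of `R` between the points with parameters `s` and `t`. -/
def arcLength (a b : ℝ) (hb : 0 < b) (s t : ℝ) : ENNReal :=
  eVariationOn (fun u => WithLp.toLp 2 (unstableCurve a b hb u)) (Set.uIcc s t)

/-- `(P - ε, P + ε)`: the points `Q` of `R` such that the arc `[P, Q]` of `R` has length less
than `ε`. -/
def arcBall (a b : ℝ) (hb : 0 < b) (P : ℝ × ℝ) (ε : ℝ) : Set (ℝ × ℝ) :=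
  {Q | ∃ s t : ℝ, unstableCurve a b hb s = P ∧ unstableCurve a b hb t = Q ∧
    arcLength a b hb s t < ENNReal.ofReal ε}

/-- The set `Σ_R^e` of essential `R`-itineraries: itineraries `p` of points `P` of `R` such that,
whenever the orbit of `P` is on the vertical axis at a time `l` but not for the first time, `p l`
is the side of the axis on which `L^l` maps the points near `P` in `R`. -/
def essentialR (a b : ℝ) (hb : 0 < b) : Set (ℤ → Bool) :=
  {p | ∃ P ∈ unstableX a b hb, IsItinerary a b hb P p ∧
    ∀ l : ℤ, ((lozi a b hb ^ l) P).1 = 0 → (∃ k < l, ((lozi a b hb ^ k) P).1 = 0) →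
      ∃ ε > 0, ∀ Q ∈ arcBall a b hb P ε, Q ≠ P →
        (p l = true → 0 < ((lozi a b hb ^ l) Q).1) ∧
        (p l = false → ((lozi a b hb ^ l) Q).1 < 0)}

/-- The set `Σ_Λ^e` of essential admissible sequences, the closure of `Σ_R^e` in the product
topology. -/
def essentialAdmissible (a b : ℝ) (hb : 0 < b) : Set (ℤ → Bool) :=
  closure (essentialR a b hb)

end Lozi

end

/-!
In coordinates adapted to the eigenvalues `-m < -1` and `0 < ν < 1` of the derivative of the Lozi
map `L` at the fixed point `X`, everything relevant about the triangle `Δ` is rational in `m` and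
`ν`. Three facts about the dynamics carry the theorem.

* An itinerary determines its point. While two orbits are in the same closed half-planes, the first
  coordinates `dₙ` of their difference satisfy `a |dₙ| ≤ |dₙ₊₁| + b |dₙ₋₁|` (`mul_abs_sub_le`);
  since `a > 1 + b`, a bounded such sequence vanishes (`IsItinerary.unique`).
* The unstable manifold `R` of `X` is dense in the attractor `Λ`
  (`attractor_subset_closure_unstableX`). The stable line of `X` cuts `Δ` into two parts; the
  boundary of the right part, `core`, consists of arcs of `R` and of a segment of the stable line
  (`frontier_core`). Each point of `Λ` has been in `core` infinitely often (`exists_mem_core`), and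
  `L` contracts area, so each point of `Λ` is close to the image of this boundary under a high
  iterate of `L`, hence to `R`.
* Along `R` the same inequality gives expansion (`curveFst_ne`): two points of `R` that have been in
  the same half-planes at all times before `n` have different first coordinates at time `n`.
  Consequently the points of `R` whose orbits avoid the vertical axis are dense in `R`
  (`dense_forall_curveFst_ne_zero`), and an arc of `R` crosses the axis on its first visit to it
  (`mem_closure_of_first_zero`).

The set of admissible sequences is closed and the coding has compact graph over closed sets of
sequences. Points of `R` whose orbits avoid the axis have only one itinerary, and it is essential,
so the essential sequences code a closed set that contains a dense subset of `Λ`. Finally, let `Ξ`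
be a compact set of admissible sequences that codes all of `Λ`, and let `p` be an essential
itinerary of `P ∈ R`. On the side of `P` in `R` on which the first visit to the axis is resolved as
`p` prescribes, all itineraries of points close to `P` agree with `p` at any given time
(`exists_filter_of_mem_essentialR`). As `Ξ` contains an itinerary of each of these points, `p` is
in `Ξ`.
-/

noncomputable section

namespace Lozi

/-! ### Eigenvalue parameters -/

/-- `-m` and `ν` are the eigenvalues of the derivative of the Lozi map in the right half-plane (so
`m` and `-ν` are those in the left one), subject to the inequalities that the hypotheses on `a`
and `b` impose on them. In these parameters all vertices and invariant lines are rational. -/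
structure Eigen (a b m ν : ℝ) : Prop where
  a_eq : a = m - ν
  b_eq : b = m * ν
  ν_pos : 0 < ν
  ν_lt : ν < 1 / 4
  m_lt : m < 2
  lt_m : 7 / 5 < m
  sq_lt : (m * ν + 2) ^ 2 < 2 * (m - ν) ^ 2

theorem exists_eigen {a b : ℝ} (hb : 0 < b) (h₁ : b + 2 < a * √2) (h₃ : 2 * a + b < 4) :
    ∃ m ν, Eigen a b m ν := by
  have h2 : √2 ^ 2 = 2 := Real.sq_sqrt (by norm_num)
  have h2p : 0 < √2 := by positivity
  have ha : 0 < a := by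
    by_contra h
    nlinarith
  have hsq : (b + 2) ^ 2 < 2 * a ^ 2 := by
    have : (b + 2) ^ 2 < (a * √2) ^ 2 := by gcongr
    nlinarith
  obtain ⟨r, hr⟩ : ∃ r, r = √(a ^ 2 + 4 * b) := ⟨_, rfl⟩
  have hr2 : r ^ 2 = a ^ 2 + 4 * b := by rw [hr]; exact Real.sq_sqrt (by positivity)
  have hr0 : 0 ≤ r := by rw [hr]; positivity
  have har : a < r := by nlinarith
  have hr4 : r < 4 - a := by nlinarith
  obtain ⟨m, hm⟩ : ∃ m, m = (a + r) / 2 := ⟨_, rfl⟩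
  obtain ⟨ν, hν⟩ : ∃ ν, ν = (r - a) / 2 := ⟨_, rfl⟩
  have hab : b = m * ν := by rw [hm, hν]; nlinarith
  have haa : a = m - ν := by rw [hm, hν]; ring
  have hν0 : 0 < ν := by rw [hν]; linarith
  have hm0 : 0 < m := by rw [hm]; linarith
  have hm2 : m < 2 := by rw [hm]; linarith
  have hsq' : (m * ν + 2) ^ 2 < 2 * (m - ν) ^ 2 := by rw [← hab, ← haa]; exact hsq
  have hν4 : ν < 1 / 4 := by
    by_contra! hc
    have i1 : (m * (1 / 4) + 2) ^ 2 ≤ (m * ν + 2) ^ 2 := by gcongr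
    have i2 : (m - ν) ^ 2 ≤ (m - 1 / 4) ^ 2 := by
      have : 0 ≤ m - ν := by rw [← haa]; exact ha.le
      gcongr
    have i3 := mul_pos hm0 (sub_pos.2 hm2)
    linarith
  have hm5 : 7 / 5 < m := by
    by_contra! hc
    have i1 : (m - ν) ^ 2 ≤ (7 / 5) ^ 2 := by
      have : 0 ≤ m - ν := by rw [← haa]; exact ha.le
      have : m - ν ≤ 7 / 5 := by linarith
      gcongr
    have i2 : 0 < m * ν := by positivity
    linarith [sq_nonneg (m * ν)]
  exact ⟨m, ν, haa, hab, hν0, hν4, hm2, hm5, hsq'⟩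

namespace Eigen

variable {a b m ν : ℝ}

theorem b_lt_a_sub_one (h : Eigen a b m ν) : b + 1 < a := by
  have := h.ν_pos; have := h.ν_lt; have := h.m_lt; have := h.lt_m
  rw [h.a_eq, h.b_eq]
  by_contra! hc
  have i : (m - ν) ^ 2 ≤ (m * ν + 1) ^ 2 := by
    have : 0 ≤ m - ν := by linarith
    gcongr
  have hs := h.sq_lt
  have i1 : m * ν < 1 / 2 := by nlinarith
  have i0 : 0 < m * ν := by positivity
  nlinarith

theorem m_gt (h : Eigen a b m ν) : 7 / 5 + 2 * ν < m := by
  have hν := h.ν_pos; have := h.ν_lt; have := h.m_lt; have hm := h.lt_m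
  by_contra! hc
  have i1 : (m - ν) ^ 2 ≤ (7 / 5 + ν) ^ 2 := by
    have : 0 ≤ m - ν := by linarith
    have : m - ν ≤ 7 / 5 + ν := by linarith
    gcongr
  have i2 : (7 / 5 * ν + 2) ^ 2 ≤ (m * ν + 2) ^ 2 := by gcongr
  nlinarith [h.sq_lt]

theorem b_lt_one (h : Eigen a b m ν) : b < 1 := by
  have := h.ν_pos; have := h.ν_lt; have := h.m_lt; have := h.lt_m
  rw [h.b_eq]
  nlinarith

theorem fixedX_eq (h : Eigen a b m ν) :
    fixedX a b = (1 / ((1 + m) * (1 - ν)), m * ν / ((1 + m) * (1 - ν))) := by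
  have e : 1 + a - b = (1 + m) * (1 - ν) := by rw [h.a_eq, h.b_eq]; ring
  rw [fixedX, e, h.b_eq]

theorem sqrt_eq (h : Eigen a b m ν) : √(a ^ 2 + 4 * b) = m + ν := by
  have := h.ν_pos; have := h.lt_m
  rw [h.a_eq, h.b_eq, show (m - ν) ^ 2 + 4 * (m * ν) = (m + ν) ^ 2 by ring]
  exact Real.sqrt_sq (by linarith)

theorem unstableEigenvalue_eq (h : Eigen a b m ν) : unstableEigenvalue a b = -m := by
  rw [unstableEigenvalue, h.sqrt_eq, h.a_eq]
  ring

theorem pointZ_eq (h : Eigen a b m ν) : pointZ a b = (1 / (1 - ν), 0) := by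
  have := h.ν_lt; have := h.lt_m
  have e : 1 + a - b = (1 + m) * (1 - ν) := by rw [h.a_eq, h.b_eq]; ring
  have h1 : 1 - ν ≠ 0 := by linarith
  have h2 : 1 + m ≠ 0 := by linarith
  rw [pointZ, h.sqrt_eq, e, h.a_eq, Prod.mk.injEq]
  refine ⟨?_, rfl⟩
  field_simp
  ring

end Eigen

theorem lozi_apply (a b : ℝ) (hb : 0 < b) (P : ℝ × ℝ) :
    lozi a b hb P = (1 + P.2 - a * |P.1|, b * P.1) := rfl

variable {a b m ν : ℝ} {hb : 0 < b}

theorem lozi_pointZ (h : Eigen a b m ν) :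
    lozi a b hb (pointZ a b) = ((1 - m) / (1 - ν), m * ν / (1 - ν)) := by
  have h1 : 0 < 1 - ν := by linarith [h.ν_lt]
  rw [h.pointZ_eq, lozi_apply, abs_of_pos (by positivity), h.a_eq, h.b_eq, Prod.mk.injEq]
  constructor
  · field_simp
    ring
  · field_simp

theorem lozi_lozi_pointZ (h : Eigen a b m ν) :
    lozi a b hb (lozi a b hb (pointZ a b)) =
      ((1 - 2 * ν + m - m ^ 2 + 2 * m * ν) / (1 - ν), m * ν * (1 - m) / (1 - ν)) := by
  have h1 : 0 < 1 - ν := by linarith [h.ν_lt]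
  have h2 : (1 - m) / (1 - ν) < 0 := div_neg_of_neg_of_pos (by linarith [h.lt_m]) h1
  rw [lozi_pointZ h, lozi_apply, abs_of_neg h2, h.a_eq, h.b_eq, Prod.mk.injEq]
  constructor
  · field_simp
    ring
  · field_simp

/-! ### The trapping triangle -/

theorem le_of_mem_triangle (α β c : ℝ)
    (h0 : α * (pointZ a b).1 + β * (pointZ a b).2 ≤ c)
    (h1 : α * (lozi a b hb (pointZ a b)).1 + β * (lozi a b hb (pointZ a b)).2 ≤ c)
    (h2 : α * (lozi a b hb (lozi a b hb (pointZ a b))).1 +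
      β * (lozi a b hb (lozi a b hb (pointZ a b))).2 ≤ c)
    {P : ℝ × ℝ} (hP : P ∈ triangle a b hb) : α * P.1 + β * P.2 ≤ c := by
  have hlin : IsLinearMap ℝ fun P : ℝ × ℝ => α * P.1 + β * P.2 :=
    ⟨fun x y => by simp only [Prod.fst_add, Prod.snd_add]; ring,
     fun r x => by simp only [Prod.smul_fst, Prod.smul_snd, smul_eq_mul]; ring⟩
  have hsub : triangle a b hb ⊆ {P : ℝ × ℝ | α * P.1 + β * P.2 ≤ c} := by
    refine convexHull_min ?_ (convex_halfSpace_le hlin c)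
    rintro Q (rfl | rfl | rfl)
    exacts [h0, h1, h2]
  exact hsub hP

/-- Nonnegative on `Δ`, zero on the edge from `Z` to `L Z`, which lies on the unstable line
of `X`. -/
def upperForm (ν : ℝ) (P : ℝ × ℝ) : ℝ := ν / (1 - ν) - ν * P.1 - P.2

/-- Nonnegative on `Δ`, zero on the edge from `Z` to `L² Z`. -/
def lowerForm (m ν : ℝ) (P : ℝ × ℝ) : ℝ :=
  m * ν / (1 - ν) - m * ν * P.1 + (m - 2 * ν) * P.2

/-- Nonnegative on `Δ`, zero on the edge from `L Z` to `L² Z`. -/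
def sideForm (m ν : ℝ) (P : ℝ × ℝ) : ℝ :=
  m ^ 2 * ν * (P.1 - (1 - m) / (1 - ν)) +
    (2 * m - 2 * ν - m ^ 2 + 2 * m * ν) * (P.2 - m * ν / (1 - ν))

theorem mem_triangle_iff (h : Eigen a b m ν) {P : ℝ × ℝ} :
    P ∈ triangle a b hb ↔ 0 ≤ upperForm ν P ∧ 0 ≤ lowerForm m ν P ∧ 0 ≤ sideForm m ν P := by
  have hν := h.ν_pos
  have hm := h.lt_m
  have h1 : 0 < 1 - ν := by linarith [h.ν_lt]
  have hm0 : 0 < m := by linarith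
  have hm1 : 0 < m - 1 := by linarith
  have hmν : 0 < m - ν := by linarith [h.ν_lt]
  constructor
  · intro hP
    refine ⟨?_, ?_, ?_⟩
    · have := le_of_mem_triangle (hb := hb) ν 1 (ν / (1 - ν)) (a := a) (b := b) ?_ ?_ ?_ hP
      · unfold upperForm; linarith
      · rw [h.pointZ_eq]; apply le_of_eq; field_simp; ring
      · rw [lozi_pointZ h]; apply le_of_eq; field_simp; ring
      · rw [lozi_lozi_pointZ h]
        rw [← sub_nonneg]
        have : ν / (1 - ν) - (ν * ((1 - 2 * ν + m - m ^ 2 + 2 * m * ν) / (1 - ν)) +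
          1 * (m * ν * (1 - m) / (1 - ν))) = 2 * ν * (m - 1) * (m - ν) / (1 - ν) := by
          field_simp; ring
        simp only [this]
        positivity
    · have := le_of_mem_triangle (hb := hb) (m * ν) (-(m - 2 * ν)) (m * ν / (1 - ν))
        (a := a) (b := b) ?_ ?_ ?_ hP
      · unfold lowerForm; linarith
      · rw [h.pointZ_eq]; apply le_of_eq; field_simp; ring
      · rw [lozi_pointZ h]
        rw [← sub_nonneg]
        have : m * ν / (1 - ν) - (m * ν * ((1 - m) / (1 - ν)) +
          -(m - 2 * ν) * (m * ν / (1 - ν))) = 2 * (m - ν) * (m * ν) / (1 - ν) := by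
          field_simp; ring
        simp only [this]
        positivity
      · rw [lozi_lozi_pointZ h]; apply le_of_eq; field_simp; ring
    · have := le_of_mem_triangle (hb := hb) (-(m ^ 2 * ν))
        (-(2 * m - 2 * ν - m ^ 2 + 2 * m * ν))
        (-(m ^ 2 * ν * ((1 - m) / (1 - ν)) +
          (2 * m - 2 * ν - m ^ 2 + 2 * m * ν) * (m * ν / (1 - ν))))
        (a := a) (b := b) ?_ ?_ ?_ hP
      · unfold sideForm; linarith
      · rw [h.pointZ_eq]
        rw [← sub_nonneg]
        have : -(m ^ 2 * ν * ((1 - m) / (1 - ν)) +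
          (2 * m - 2 * ν - m ^ 2 + 2 * m * ν) * (m * ν / (1 - ν))) -
          (-(m ^ 2 * ν) * (1 / (1 - ν)) + -(2 * m - 2 * ν - m ^ 2 + 2 * m * ν) * 0) =
            2 * (m * ν) * (m - 1) * (m - ν) / (1 - ν) := by
          field_simp; ring
        simp only [this]
        positivity
      · rw [lozi_pointZ h]; apply le_of_eq; simp only []; ring
      · rw [lozi_lozi_pointZ h]; apply le_of_eq; field_simp; ring
  · rintro ⟨hu, hl, hs⟩
    -- The three forms, normalized by their values at the opposite vertices, are the barycentric
    -- coordinates with respect to the triangle.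
    obtain ⟨w, hw⟩ : ∃ w : Fin 3 → ℝ, w = ![
      sideForm m ν P * (1 - ν) / (2 * (m * ν) * (m - 1) * (m - ν)),
      lowerForm m ν P * (1 - ν) / (2 * (m - ν) * (m * ν)),
      upperForm ν P * (1 - ν) / (2 * ν * (m - 1) * (m - ν))] := ⟨_, rfl⟩
    have hsum := (convex_convexHull ℝ {pointZ a b, lozi a b hb (pointZ a b),
      lozi a b hb (lozi a b hb (pointZ a b))}).sum_mem (t := Finset.univ) (w := w)
      (z := ![pointZ a b, lozi a b hb (pointZ a b), lozi a b hb (lozi a b hb (pointZ a b))])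
      ?_ ?_ ?_
    · change P ∈ convexHull ℝ _
      convert hsum using 1
      rw [Fin.sum_univ_three, hw]
      simp only [Matrix.cons_val_zero, Matrix.cons_val_one, Matrix.cons_val]
      rw [lozi_lozi_pointZ h, lozi_pointZ h, h.pointZ_eq]
      unfold upperForm lowerForm sideForm
      ext
      · simp only [Prod.fst_add, Prod.smul_fst, smul_eq_mul]
        field_simp
        ring
      · simp only [Prod.snd_add, Prod.smul_snd, smul_eq_mul]
        field_simp
        ring
    · intro i _
      rw [hw]
      fin_cases i
      · exact div_nonneg (mul_nonneg hs h1.le) (by positivity)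
      · exact div_nonneg (mul_nonneg hl h1.le) (by positivity)
      · exact div_nonneg (mul_nonneg hu h1.le) (by positivity)
    · rw [Fin.sum_univ_three, hw]
      simp only [Matrix.cons_val_zero, Matrix.cons_val_one, Matrix.cons_val]
      unfold upperForm lowerForm sideForm
      field_simp
      ring
    · intro i _
      apply subset_convexHull
      fin_cases i <;> simp

/-- `Δ` is mapped into itself. On each half-plane the pullbacks of the three forms are nonnegative
combinations of the forms and of `|x|`; the coefficients are found by evaluation at the vertices
of `Δ`. -/
theorem lozi_mem_triangle (h : Eigen a b m ν) {P : ℝ × ℝ} (hP : P ∈ triangle a b hb) :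
    lozi a b hb P ∈ triangle a b hb := by
  have hν := h.ν_pos
  have hν4 := h.ν_lt
  have hm := h.lt_m
  have hm2 := h.m_lt
  have h1 : 0 < 1 - ν := by linarith
  have hm0 : 0 < m := by linarith
  have hm1 : 0 < m - 1 := by linarith
  have hmν : 0 < m - ν := by linarith
  rw [mem_triangle_iff h] at hP ⊢
  obtain ⟨hu, hl, hs⟩ := hP
  rw [lozi_apply, h.a_eq, h.b_eq]
  rcases le_total 0 P.1 with hx | hx
  · rw [abs_of_nonneg hx]
    refine ⟨?_, ?_, ?_⟩
    · have : upperForm ν (1 + P.2 - (m - ν) * P.1, m * ν * P.1) = ν * upperForm ν P := by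
        unfold upperForm; field_simp; ring
      rw [this]; positivity
    · have : lowerForm m ν (1 + P.2 - (m - ν) * P.1, m * ν * P.1) =
          m * ν * (upperForm ν P + 2 * (m - ν) * P.1) := by
        unfold upperForm lowerForm; field_simp; ring
      rw [this]; positivity
    · have : sideForm m ν (1 + P.2 - (m - ν) * P.1, m * ν * P.1) =
          m * (m - 1) * lowerForm m ν P +
          m * ((m - 2 * ν) * (2 * (m - 1) * (m - ν) - m * ν) - m ^ 2 * ν) / (2 * (m - ν)) *
            upperForm ν P := by
        unfold upperForm lowerForm sideForm; field_simp; ring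
      rw [this]
      have hc : 0 ≤ (m - 2 * ν) * (2 * (m - 1) * (m - ν) - m * ν) - m ^ 2 * ν := by
        have i1 := h.m_gt
        have i2 : (2 / 5 + 2 * ν) * (7 / 5 + ν) ≤ (m - 1) * (m - ν) := by
          apply mul_le_mul <;> linarith
        have i3 : m * ν ≤ 2 * ν := by gcongr
        have i4 : 7 / 5 * (28 / 25 + 4 * ν) ≤
            (m - 2 * ν) * (2 * (m - 1) * (m - ν) - m * ν) := by
          apply mul_le_mul <;> nlinarith
        nlinarith [mul_pos hm0 hν]
      have := div_nonneg (mul_nonneg hm0.le hc) (by positivity : 0 ≤ 2 * (m - ν))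
      positivity
  · rw [abs_of_nonpos hx]
    refine ⟨?_, ?_, ?_⟩
    · have : upperForm ν (1 + P.2 - (m - ν) * -P.1, m * ν * P.1) =
          ν * (upperForm ν P + 2 * (m - ν) * -P.1) := by
        unfold upperForm; field_simp; ring
      have hx' : 0 ≤ -P.1 := by linarith
      rw [this]; positivity
    · have : lowerForm m ν (1 + P.2 - (m - ν) * -P.1, m * ν * P.1) =
          m * ν * upperForm ν P := by
        unfold upperForm lowerForm; field_simp; ring
      rw [this]; positivity
    · have : sideForm m ν (1 + P.2 - (m - ν) * -P.1, m * ν * P.1) =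
          m / (m - 1) * sideForm m ν P +
          m * (2 - m) * (m - ν + m * ν) / (m - 1) * upperForm ν P := by
        unfold upperForm sideForm; field_simp; ring
      rw [this]
      have : 0 < 2 - m := by linarith
      positivity

/-! ### Iterates and the attractor -/

theorem continuous_lozi : Continuous (lozi a b hb) := by
  change Continuous fun P : ℝ × ℝ => (1 + P.2 - a * |P.1|, b * P.1)
  fun_prop

theorem continuous_lozi_inv : Continuous ⇑(lozi a b hb)⁻¹ := by
  change Continuous fun P : ℝ × ℝ => (P.2 / b, P.1 - 1 + a * |P.2 / b|)
  fun_prop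

theorem continuous_lozi_zpow (n : ℤ) : Continuous ⇑(lozi a b hb ^ n) := by
  have key : ∀ (f : Equiv.Perm (ℝ × ℝ)), Continuous f → ∀ k : ℕ, Continuous ⇑(f ^ k) := by
    intro f hf k
    rw [Equiv.Perm.coe_pow]
    exact hf.iterate k
  obtain ⟨k, rfl | rfl⟩ := n.eq_nat_or_neg
  · rw [zpow_natCast]
    exact key _ continuous_lozi k
  · rw [zpow_neg, zpow_natCast, ← inv_pow]
    exact key _ continuous_lozi_inv k

/-- The iterates of the Lozi map as homeomorphisms of the plane. -/
def loziHomeo (a b : ℝ) (hb : 0 < b) (n : ℤ) : (ℝ × ℝ) ≃ₜ (ℝ × ℝ) where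
  toEquiv := lozi a b hb ^ n
  continuous_toFun := continuous_lozi_zpow n
  continuous_invFun := by
    change Continuous ⇑((lozi a b hb ^ n)⁻¹)
    rw [← zpow_neg]
    exact continuous_lozi_zpow (-n)

theorem zpow_add_apply (n k : ℤ) (P : ℝ × ℝ) :
    (lozi a b hb ^ (n + k)) P = (lozi a b hb ^ n) ((lozi a b hb ^ k) P) := by
  rw [zpow_add, Equiv.Perm.mul_apply]

theorem zpow_neg_apply_zpow (n : ℤ) (P : ℝ × ℝ) :
    (lozi a b hb ^ (-n)) ((lozi a b hb ^ n) P) = P := by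
  rw [← zpow_add_apply, neg_add_cancel, zpow_zero, Equiv.Perm.one_apply]

theorem zpow_apply_zpow_neg (n : ℤ) (P : ℝ × ℝ) :
    (lozi a b hb ^ n) ((lozi a b hb ^ (-n)) P) = P := by
  rw [← zpow_add_apply, add_neg_cancel, zpow_zero, Equiv.Perm.one_apply]

theorem zpow_succ_apply (n : ℤ) (P : ℝ × ℝ) :
    (lozi a b hb ^ (n + 1)) P = lozi a b hb ((lozi a b hb ^ n) P) := by
  rw [add_comm, zpow_add_apply, zpow_one]

theorem zpow_snd (n : ℤ) (P : ℝ × ℝ) :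
    ((lozi a b hb ^ n) P).2 = b * ((lozi a b hb ^ (n - 1)) P).1 := by
  conv_lhs => rw [← sub_add_cancel n 1, zpow_succ_apply, lozi_apply]

/-- The first coordinates of an orbit satisfy a second-order recurrence. -/
theorem zpow_succ_fst (n : ℤ) (P : ℝ × ℝ) :
    ((lozi a b hb ^ (n + 1)) P).1 =
      1 + b * ((lozi a b hb ^ (n - 1)) P).1 - a * |((lozi a b hb ^ n) P).1| := by
  rw [zpow_succ_apply, lozi_apply, zpow_snd n P]

theorem abs_abs_sub_abs_of_mul_nonneg {x y : ℝ} (h : 0 ≤ x * y) : |(|x| - |y|)| = |x - y| := by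
  rcases le_total 0 x with hx | hx <;> rcases le_total 0 y with hy | hy
  · rw [abs_of_nonneg hx, abs_of_nonneg hy]
  · have h' : x * y = 0 := le_antisymm (mul_nonpos_of_nonneg_of_nonpos hx hy) h
    rcases mul_eq_zero.1 h' with rfl | rfl <;> simp
  · have h' : x * y = 0 := le_antisymm (mul_nonpos_of_nonpos_of_nonneg hx hy) h
    rcases mul_eq_zero.1 h' with rfl | rfl <;> simp
  · rw [abs_of_nonpos hx, abs_of_nonpos hy, ← abs_neg]
    congr 1
    ring

/-- As long as two orbits are in the same closed half-plane, the first coordinate of their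
difference satisfies this convexity-like inequality; it drives both forward and backward
expansion. -/
theorem mul_abs_sub_le (ha : 0 < a) {n : ℤ} {P Q : ℝ × ℝ}
    (h : 0 ≤ ((lozi a b hb ^ n) P).1 * ((lozi a b hb ^ n) Q).1) :
    a * |((lozi a b hb ^ n) P).1 - ((lozi a b hb ^ n) Q).1| ≤
      |((lozi a b hb ^ (n + 1)) P).1 - ((lozi a b hb ^ (n + 1)) Q).1| +
        b * |((lozi a b hb ^ (n - 1)) P).1 - ((lozi a b hb ^ (n - 1)) Q).1| := by
  rw [← abs_abs_sub_abs_of_mul_nonneg h, zpow_succ_fst, zpow_succ_fst]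
  generalize ((lozi a b hb ^ n) P).1 = x
  generalize ((lozi a b hb ^ n) Q).1 = y
  generalize ((lozi a b hb ^ (n - 1)) P).1 = z
  generalize ((lozi a b hb ^ (n - 1)) Q).1 = w
  rw [← abs_of_pos ha, ← abs_mul, abs_of_pos ha]
  conv_rhs => rw [← abs_of_pos hb, ← abs_mul, abs_of_pos hb]
  have e : a * (|x| - |y|) = -(1 + b * z - a * |x| - (1 + b * w - a * |y|)) + b * (z - w) := by
    ring
  rw [e]
  refine (abs_add_le _ _).trans ?_
  rw [abs_neg]

theorem isCompact_triangle : IsCompact (triangle a b hb) :=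
  Set.Finite.isCompact_convexHull _ (Set.toFinite _)

theorem mem_attractor_iff {P : ℝ × ℝ} :
    P ∈ attractor a b hb ↔ ∀ n : ℕ, (lozi a b hb ^ (-(n : ℤ))) P ∈ triangle a b hb := by
  simp only [attractor, Set.mem_iInter]
  refine forall_congr' fun n => ?_
  rw [Equiv.image_eq_preimage_symm, Set.mem_preimage, zpow_neg, zpow_natCast]
  rfl

theorem pow_mem_triangle (h : Eigen a b m ν) {P : ℝ × ℝ} (hP : P ∈ triangle a b hb) (n : ℕ) :
    (lozi a b hb ^ n) P ∈ triangle a b hb := by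
  induction n with
  | zero => simpa using hP
  | succ n ih =>
    rw [pow_succ', Equiv.Perm.mul_apply]
    exact lozi_mem_triangle h ih

theorem zpow_mem_triangle (h : Eigen a b m ν) {P : ℝ × ℝ} (hP : P ∈ attractor a b hb) (n : ℤ) :
    (lozi a b hb ^ n) P ∈ triangle a b hb := by
  rw [mem_attractor_iff] at hP
  obtain ⟨k, rfl | rfl⟩ := n.eq_nat_or_neg
  · have := pow_mem_triangle h (hP 0) k
    simpa using this
  · exact hP k

theorem isCompact_attractor : IsCompact (attractor a b hb) := by
  have hc : ∀ n : ℕ, IsCompact ((lozi a b hb ^ n) '' triangle a b hb) := fun n => by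
    have := continuous_lozi_zpow (a := a) (b := b) (hb := hb) n
    rw [zpow_natCast] at this
    exact isCompact_triangle.image this
  exact (hc 0).of_isClosed_subset (isClosed_iInter fun n => (hc n).isClosed)
    (Set.iInter_subset _ 0)

theorem exists_abs_fst_le : ∃ K, ∀ P ∈ triangle a b hb, |P.1| ≤ K := by
  obtain ⟨K, hK⟩ := isCompact_triangle (a := a) (b := b) (hb := hb).exists_bound_of_continuousOn
    (f := fun P : ℝ × ℝ => P.1) continuous_fst.continuousOn
  exact ⟨K, hK⟩

theorem IsItinerary.mul_nonneg {P Q : ℝ × ℝ} {p : ℤ → Bool} (hP : IsItinerary a b hb P p)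
    (hQ : IsItinerary a b hb Q p) (n : ℤ) :
    0 ≤ ((lozi a b hb ^ n) P).1 * ((lozi a b hb ^ n) Q).1 := by
  cases hp : p n
  · exact mul_nonneg_of_nonpos_of_nonpos ((hP n).2 hp) ((hQ n).2 hp)
  · exact _root_.mul_nonneg ((hP n).1 hp) ((hQ n).1 hp)

/-- An itinerary determines the point of the attractor: by `mul_abs_sub_le`, the supremum `S` of
the distances between the first coordinates along the two orbits satisfies
`a * S ≤ (1 + b) * S`. -/
theorem IsItinerary.unique (h : Eigen a b m ν) {P Q : ℝ × ℝ} {p : ℤ → Bool}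
    (hPΛ : P ∈ attractor a b hb) (hQΛ : Q ∈ attractor a b hb)
    (hP : IsItinerary a b hb P p) (hQ : IsItinerary a b hb Q p) : P = Q := by
  have hab := h.b_lt_a_sub_one
  obtain ⟨K, hK⟩ := exists_abs_fst_le (a := a) (b := b) (hb := hb)
  obtain ⟨e, he⟩ : ∃ e : ℤ → ℝ,
    e = fun n => |((lozi a b hb ^ n) P).1 - ((lozi a b hb ^ n) Q).1| := ⟨_, rfl⟩
  have hbdd : BddAbove (Set.range e) := by
    refine ⟨K + K, ?_⟩
    rintro _ ⟨n, rfl⟩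
    rw [he]
    exact (abs_sub _ _).trans (add_le_add (hK _ (zpow_mem_triangle h hPΛ n))
      (hK _ (zpow_mem_triangle h hQΛ n)))
  have hle : ∀ n, e n ≤ (1 + b) / a * ⨆ k, e k := by
    intro n
    have h1 := mul_abs_sub_le (a := a) (hb := hb) (by linarith) (hP.mul_nonneg hQ n)
    have h2 := le_ciSup hbdd (n + 1)
    have h3 := mul_le_mul_of_nonneg_left (le_ciSup hbdd (n - 1)) hb.le
    rw [div_mul_eq_mul_div, le_div_iff₀ (by linarith)]
    rw [he] at h2 h3 ⊢
    linarith
  have hS : (⨆ k, e k) ≤ (1 + b) / a * ⨆ k, e k := ciSup_le hle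
  have hS0 : (⨆ k, e k) ≤ 0 := by
    by_contra! hpos
    have : (1 + b) / a < 1 := by rw [div_lt_one (by linarith)]; linarith
    nlinarith
  have hzero : ∀ n : ℤ, ((lozi a b hb ^ n) P).1 = ((lozi a b hb ^ n) Q).1 := fun n => by
    have h1 := (le_ciSup hbdd n).trans hS0
    rw [he] at h1
    exact sub_eq_zero.1 (abs_nonpos_iff.1 h1)
  have h0 := hzero 0
  have h1 : ((lozi a b hb ^ (0 : ℤ)) P).2 = ((lozi a b hb ^ (0 : ℤ)) Q).2 := by
    rw [zpow_snd, zpow_snd, hzero]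
  exact Prod.ext h0 h1

/-! ### Contraction of area -/

theorem volume_image_lozi_le (S : Set (ℝ × ℝ)) :
    MeasureTheory.volume (lozi a b hb '' S) ≤ ENNReal.ofReal b * MeasureTheory.volume S := by
  -- On each half-plane `L` is a translate of a linear map of determinant `±b`.
  have piece : ∀ (σ : ℝ) (T : Set (ℝ × ℝ)), (∀ P ∈ T, |P.1| = σ * P.1) →
      MeasureTheory.volume (lozi a b hb '' T) = ENNReal.ofReal b * MeasureTheory.volume T := by
    intro σ T hT
    obtain ⟨A, hA⟩ : ∃ A, A = Matrix.toLin (Module.Basis.finTwoProd ℝ) (Module.Basis.finTwoProd ℝ)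
      !![-(a * σ), 1; b, 0] := ⟨_, rfl⟩
    have himg : lozi a b hb '' T = (fun P => ((1, 0) : ℝ × ℝ) + P) '' (A '' T) := by
      rw [Set.image_image]
      refine Set.image_congr fun P hP => ?_
      rw [lozi_apply, hT P hP, hA, Matrix.toLin_finTwoProd_apply]
      ext
      · simp only [Prod.mk_add_mk]; ring
      · simp only [Prod.mk_add_mk]; ring
    rw [himg, Set.image_add_left, MeasureTheory.measure_preimage_add,
      MeasureTheory.Measure.addHaar_image_linearMap]
    congr 2
    rw [hA, LinearMap.det_toLin, Matrix.det_fin_two_of]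
    simp [abs_of_pos hb]
  obtain ⟨H, hH⟩ : ∃ H : Set (ℝ × ℝ), H = {P | 0 ≤ P.1} := ⟨_, rfl⟩
  have hHm : MeasurableSet H := by
    rw [hH]
    exact measurableSet_le measurable_const measurable_fst
  calc MeasureTheory.volume (lozi a b hb '' S)
      = MeasureTheory.volume (lozi a b hb '' (S ∩ H) ∪ lozi a b hb '' (S \ H)) := by
        rw [← Set.image_union, Set.inter_union_sdiff]
    _ ≤ MeasureTheory.volume (lozi a b hb '' (S ∩ H)) +
        MeasureTheory.volume (lozi a b hb '' (S \ H)) := MeasureTheory.measure_union_le _ _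
    _ = ENNReal.ofReal b * MeasureTheory.volume S := by
        rw [piece 1 (S ∩ H), piece (-1) (S \ H), ← mul_add,
          MeasureTheory.measure_inter_add_sdiff S hHm]
        · rintro P ⟨-, hP⟩
          rw [hH, Set.mem_ofPred_eq, not_le] at hP
          rw [abs_of_neg hP]
          ring
        · rintro P ⟨-, hP⟩
          rw [hH] at hP
          rw [abs_of_nonneg hP, one_mul]

theorem volume_image_pow_le (S : Set (ℝ × ℝ)) (n : ℕ) :
    MeasureTheory.volume ((lozi a b hb ^ n) '' S) ≤
      ENNReal.ofReal b ^ n * MeasureTheory.volume S := by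
  induction n with
  | zero => simp
  | succ n ih =>
    have e : (lozi a b hb ^ (n + 1)) '' S = lozi a b hb '' ((lozi a b hb ^ n) '' S) := by
      rw [Set.image_image, pow_succ']
      rfl
    rw [e, pow_succ', mul_assoc]
    exact (volume_image_lozi_le _).trans (by gcongr)

/-! ### The unstable line of the fixed point -/

/-- The unstable line of `X`, parametrized so that the derivative of `L` at `X` multiplies the
parameter by the unstable eigenvalue. -/
def unstableLine (a b t : ℝ) : ℝ × ℝ := fixedX a b + t • (unstableEigenvalue a b, b)

theorem unstableLine_eq (h : Eigen a b m ν) (t : ℝ) :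
    unstableLine a b t =
      (1 / ((1 + m) * (1 - ν)) - t * m, m * ν / ((1 + m) * (1 - ν)) + t * (m * ν)) := by
  rw [unstableLine, h.fixedX_eq, h.unstableEigenvalue_eq, h.b_eq]
  ext
  · simp only [Prod.fst_add, Prod.smul_fst, smul_eq_mul]; ring
  · simp only [Prod.snd_add, Prod.smul_snd, smul_eq_mul]

theorem continuous_unstableLine : Continuous (unstableLine a b) := by
  unfold unstableLine
  fun_prop

/-- The parameters of the edge of `Δ` from `Z` to `L Z` on the unstable line of `X`. -/
def edgeParams (m ν : ℝ) : Set ℝ :=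
  Set.Icc (-(1 / ((1 + m) * (1 - ν)))) (m * (1 / ((1 + m) * (1 - ν))))

theorem div_mem_edgeParams (h : Eigen a b m ν) {t : ℝ} (ht : t ∈ edgeParams m ν) :
    t / -m ∈ edgeParams m ν := by
  have hm := h.lt_m
  have h1 : 0 < (1 + m) * (1 - ν) := mul_pos (by linarith) (by linarith [h.ν_lt])
  have h2 : 0 < 1 / ((1 + m) * (1 - ν)) := by positivity
  obtain ⟨l, r⟩ := ht
  rw [edgeParams, Set.mem_Icc, div_neg]
  generalize 1 / ((1 + m) * (1 - ν)) = c at l r h2 ⊢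
  constructor
  · rw [neg_le_neg_iff, div_le_iff₀ (by linarith)]
    linarith
  · rw [neg_le, le_div_iff₀ (by linarith)]
    nlinarith [mul_pos h2 (by linarith : 0 < m - 1)]

theorem lozi_unstableLine (h : Eigen a b m ν) {t : ℝ}
    (ht : t * m ≤ 1 / ((1 + m) * (1 - ν))) :
    lozi a b hb (unstableLine a b t) = unstableLine a b (-m * t) := by
  have h1 : 1 + m ≠ 0 := by linarith [h.lt_m]
  have h2 : 1 - ν ≠ 0 := by linarith [h.ν_lt]
  rw [unstableLine_eq h, unstableLine_eq h, lozi_apply, abs_of_nonneg (by simpa using ht), h.a_eq,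
    h.b_eq]
  ext
  · simp only []
    field_simp
    ring
  · simp only []
    ring

theorem lozi_unstableLine_div (h : Eigen a b m ν) {t : ℝ} (ht : t ∈ edgeParams m ν) :
    lozi a b hb (unstableLine a b (t / -m)) = unstableLine a b t := by
  have hm : m ≠ 0 := by linarith [h.lt_m]
  rw [lozi_unstableLine h]
  · congr 1
    field_simp
  · have e : t / -m * m = -t := by field_simp
    rw [e]
    linarith [ht.1]

theorem pow_unstableLine (h : Eigen a b m ν) (n : ℕ) {t : ℝ} (ht : t ∈ edgeParams m ν) :
    (lozi a b hb ^ n) (unstableLine a b (t / (-m) ^ n)) = unstableLine a b t := by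
  induction n generalizing t with
  | zero => simp
  | succ n ih =>
    rw [pow_succ', Equiv.Perm.mul_apply, pow_succ', ← div_div, ih (div_mem_edgeParams h ht),
      lozi_unstableLine_div h ht]

theorem unstableLine_mem_triangle (h : Eigen a b m ν) {t : ℝ} (ht : t ∈ edgeParams m ν) :
    unstableLine a b t ∈ triangle a b hb := by
  have hm := h.lt_m
  have hm2 := h.m_lt
  have hν := h.ν_pos
  have hν4 := h.ν_lt
  have h1 : 0 < 1 - ν := by linarith
  have h2 : 0 < 1 + m := by linarith
  have h3 : 0 < m - ν := by linarith
  have h4 : 0 < 2 - m := by linarith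
  have h5 : 0 < m - 1 := by linarith
  obtain ⟨l, r⟩ := ht
  have l' : 0 ≤ t + 1 / ((1 + m) * (1 - ν)) := by linarith
  have r' : 0 ≤ m * (1 / ((1 + m) * (1 - ν))) - t := by linarith
  rw [mem_triangle_iff h, unstableLine_eq h]
  refine ⟨le_of_eq ?_, ?_, ?_⟩
  · unfold upperForm
    field_simp
    ring
  · have : lowerForm m ν (1 / ((1 + m) * (1 - ν)) - t * m,
        m * ν / ((1 + m) * (1 - ν)) + t * (m * ν)) =
        2 * (m - ν) * (m * ν) * (t + 1 / ((1 + m) * (1 - ν))) := by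
      unfold lowerForm
      field_simp
      ring
    rw [this]
    positivity
  · have : sideForm m ν (1 / ((1 + m) * (1 - ν)) - t * m,
        m * ν / ((1 + m) * (1 - ν)) + t * (m * ν)) =
        2 * (m * ν) * (m - 1) * (m - ν) * (m * (1 / ((1 + m) * (1 - ν))) - t) := by
      unfold sideForm
      field_simp
      ring
    rw [this]
    positivity

theorem mem_unstableX_iff {P : ℝ × ℝ} :
    P ∈ unstableX a b hb ↔
      Tendsto (fun n : ℕ => (lozi a b hb ^ (-(n : ℤ))) P) atTop (𝓝 (fixedX a b)) := by
  simp only [unstableX, Set.mem_ofPred_eq, inv_pow, zpow_neg, zpow_natCast]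

theorem lozi_fixedX (h : Eigen a b m ν) : lozi a b hb (fixedX a b) = fixedX a b := by
  have h1 : 0 < (1 + m) * (1 - ν) := mul_pos (by linarith [h.lt_m]) (by linarith [h.ν_lt])
  have := lozi_unstableLine (hb := hb) h (t := 0) (by rw [zero_mul]; positivity)
  simpa [unstableLine] using this

theorem lozi_mem_unstableX (h : Eigen a b m ν) {P : ℝ × ℝ} (hP : P ∈ unstableX a b hb) :
    lozi a b hb P ∈ unstableX a b hb := by
  rw [mem_unstableX_iff] at hP ⊢
  have := (continuous_lozi (a := a) (b := b) (hb := hb)).continuousAt.tendsto.comp hP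
  rw [lozi_fixedX h] at this
  refine this.congr fun n => ?_
  rw [Function.comp_apply, ← zpow_succ_apply, zpow_add_apply, zpow_one]

theorem pow_mem_unstableX (h : Eigen a b m ν) {P : ℝ × ℝ} (hP : P ∈ unstableX a b hb) (n : ℕ) :
    (lozi a b hb ^ n) P ∈ unstableX a b hb := by
  induction n with
  | zero => simpa using hP
  | succ n ih =>
    rw [pow_succ', Equiv.Perm.mul_apply]
    exact lozi_mem_unstableX h ih

theorem tendsto_unstableLine_div_pow (h : Eigen a b m ν) (t : ℝ) :
    Tendsto (fun n : ℕ => unstableLine a b (t / (-m) ^ n)) atTop (𝓝 (fixedX a b)) := by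
  have h0 : unstableLine a b 0 = fixedX a b := by simp [unstableLine]
  rw [← h0]
  refine (continuous_unstableLine.tendsto 0).comp ?_
  have h1 : Tendsto (fun n : ℕ => ((-m)⁻¹) ^ n) atTop (𝓝 0) := by
    apply tendsto_pow_atTop_nhds_zero_of_abs_lt_one
    rw [abs_inv, abs_neg, abs_of_pos (by linarith [h.lt_m])]
    exact inv_lt_one_of_one_lt₀ (by linarith [h.lt_m])
  have h2 := h1.const_mul t
  rw [mul_zero] at h2
  refine h2.congr fun n => ?_
  rw [inv_pow, div_eq_mul_inv]

/-- The edge of `Δ` from `Z` to `L Z` is in the unstable manifold: backward iterates stay on it. -/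
theorem unstableLine_mem_unstableX (h : Eigen a b m ν) {t : ℝ} (ht : t ∈ edgeParams m ν) :
    unstableLine a b t ∈ unstableX a b hb := by
  rw [mem_unstableX_iff]
  refine (tendsto_unstableLine_div_pow h t).congr fun n => ?_
  conv_rhs => rw [← pow_unstableLine (hb := hb) h n ht, ← zpow_natCast, zpow_neg_apply_zpow]

theorem eq_unstableLine_of_upperForm_eq_zero (h : Eigen a b m ν) {P : ℝ × ℝ}
    (hP : upperForm ν P = 0) :
    P = unstableLine a b ((1 / ((1 + m) * (1 - ν)) - P.1) / m) := by
  have h1 : 1 - ν ≠ 0 := by linarith [h.ν_lt]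
  have h2 : 1 + m ≠ 0 := by linarith [h.lt_m]
  have h3 : m ≠ 0 := by linarith [h.lt_m]
  rw [unstableLine_eq h]
  ext
  · simp only []
    field_simp
    ring
  · simp only []
    have : P.2 = ν / (1 - ν) - ν * P.1 := by unfold upperForm at hP; linarith
    rw [this]
    field_simp
    ring

/-! ### The unstable manifold is dense in the attractor -/

/-- Zero on the stable line of `X`, positive on its right. -/
def stableForm (m : ℝ) (P : ℝ × ℝ) : ℝ := m * P.1 - P.2 - m / (1 + m)

theorem stableForm_lozi (h : Eigen a b m ν) {P : ℝ × ℝ} (hP : 0 ≤ P.1) :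
    stableForm m (lozi a b hb P) = -m * stableForm m P := by
  have h2 : 1 + m ≠ 0 := by linarith [h.lt_m]
  rw [lozi_apply, abs_of_nonneg hP, h.a_eq, h.b_eq]
  unfold stableForm
  field_simp
  ring

/-- Every point of the attractor has been in the right half-plane infinitely often: the linear
form `m x + y + m / (m - 1)`, which is multiplied by `m > 1` in the left half-plane, is bounded
away from zero on `Δ`. -/
theorem exists_fst_nonneg (h : Eigen a b m ν) {P : ℝ × ℝ} (hP : P ∈ attractor a b hb) (N : ℕ) :
    ∃ n : ℕ, N ≤ n ∧ 0 ≤ ((lozi a b hb ^ (-(n : ℤ))) P).1 := by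
  have hm := h.lt_m
  have hm2 := h.m_lt
  have hν := h.ν_pos
  have hν4 := h.ν_lt
  have h1 : 0 < 1 - ν := by linarith
  have h3 : 0 < m - ν := by linarith
  have h4 : 0 < 2 - m := by linarith
  have h5 : 0 < m - 1 := by linarith
  have h0 : 0 < m := by linarith
  obtain ⟨F, hF⟩ : ∃ F : ℝ × ℝ → ℝ, F = fun P => m * P.1 + P.2 + m / (m - 1) := ⟨_, rfl⟩
  obtain ⟨δ, hδ⟩ : ∃ δ, δ = m * ((2 - m) * (m - ν)) / ((m - 1) * (1 - ν)) := ⟨_, rfl⟩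
  have hδ0 : 0 < δ := by rw [hδ]; positivity
  -- `δ` is the value of the form at `L Z`; at `L² Z` it is `m * δ`.
  have hFΔ : ∀ Q ∈ triangle a b hb, δ ≤ F Q := by
    intro Q hQ
    have := le_of_mem_triangle (hb := hb) (-m) (-1) (m / (m - 1) - δ) (a := a) (b := b) ?_ ?_ ?_ hQ
    · rw [hF]; simp only []; linarith
    · rw [h.pointZ_eq, ← sub_nonneg]
      have : m / (m - 1) - δ - (-m * (1 / (1 - ν)) + -1 * 0) = m * (m - ν) / (1 - ν) := by
        rw [hδ]; field_simp; ring
      simp only [this]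
      positivity
    · rw [lozi_pointZ h]
      apply le_of_eq
      rw [hδ]; field_simp; ring
    · rw [lozi_lozi_pointZ h, ← sub_nonneg]
      have : m / (m - 1) - δ - (-m * ((1 - 2 * ν + m - m ^ 2 + 2 * m * ν) / (1 - ν)) +
          -1 * (m * ν * (1 - m) / (1 - ν))) = (m - 1) * δ := by
        rw [hδ]; field_simp; ring
      simp only [this]
      positivity
  by_contra! hc
  have hstep : ∀ k : ℕ, m ^ k * F ((lozi a b hb ^ (-((N + k : ℕ) : ℤ))) P) =
      F ((lozi a b hb ^ (-(N : ℤ))) P) := by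
    intro k
    induction k with
    | zero => simp
    | succ k ih =>
      rw [← ih]
      have e : (-((N + k : ℕ) : ℤ)) = -((N + (k + 1) : ℕ) : ℤ) + 1 := by push_cast; ring
      have hneg := hc (N + (k + 1)) (by omega)
      rw [e, zpow_succ_apply]
      generalize (lozi a b hb ^ (-((N + (k + 1) : ℕ) : ℤ))) P = Q at hneg ⊢
      rw [lozi_apply, abs_of_neg hneg, h.a_eq, h.b_eq, hF, pow_succ, mul_assoc]
      congr 1
      field_simp
      ring
  have hle : ∀ k : ℕ, m ^ k * δ ≤ F ((lozi a b hb ^ (-(N : ℤ))) P) := fun k => by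
    rw [← hstep k]
    gcongr
    exact hFΔ _ (mem_attractor_iff.1 hP _)
  obtain ⟨k, hk⟩ := pow_unbounded_of_one_lt (F ((lozi a b hb ^ (-(N : ℤ))) P) / δ)
    (by linarith : 1 < m)
  rw [div_lt_iff₀ hδ0] at hk
  exact absurd (hle k) (not_le.2 hk)

/-- The part of `Δ` on the right of the stable line of `X`. It avoids the edge from `L Z` to
`L² Z`, so its boundary consists of arcs of the unstable and of the stable manifold of `X`. -/
def core (a b m : ℝ) (hb : 0 < b) : Set (ℝ × ℝ) := {P ∈ triangle a b hb | 0 ≤ stableForm m P}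

theorem continuous_stableForm : Continuous (stableForm m) := by
  unfold stableForm
  fun_prop

theorem isCompact_core : IsCompact (core a b m hb) :=
  isCompact_triangle.inter_right (isClosed_le continuous_const continuous_stableForm)

/-- The orbit of a point of the attractor is in `core` at infinitely many negative times: `L` maps
the left side of the stable line of `X`, as far as it is in the right half-plane, to its right
side. -/
theorem exists_mem_core (h : Eigen a b m ν) {P : ℝ × ℝ} (hP : P ∈ attractor a b hb) (N : ℕ) :
    ∃ n : ℕ, N ≤ n ∧ (lozi a b hb ^ (-(n : ℤ))) P ∈ core a b m hb := by
  obtain ⟨n, hn, hx⟩ := exists_fst_nonneg h hP (N + 1)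
  rcases le_or_gt 0 (stableForm m ((lozi a b hb ^ (-(n : ℤ))) P)) with hg | hg
  · exact ⟨n, by omega, mem_attractor_iff.1 hP n, hg⟩
  · obtain ⟨k, rfl⟩ : ∃ k, n = k + 1 := ⟨n - 1, by omega⟩
    refine ⟨k, by omega, mem_attractor_iff.1 hP k, ?_⟩
    have e : (-(k : ℤ)) = -((k + 1 : ℕ) : ℤ) + 1 := by push_cast; ring
    rw [e, zpow_succ_apply, stableForm_lozi h hx]
    have := h.lt_m
    nlinarith

/-- The stable line of `X` leaves `Δ` through the edge from `Z` to `L² Z`, before it reaches the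
vertical axis. -/
theorem fst_nonneg_of_stableForm_eq_zero (h : Eigen a b m ν) {P : ℝ × ℝ}
    (hP : P ∈ triangle a b hb) (hg : stableForm m P = 0) : 0 ≤ P.1 := by
  have hm := h.m_gt
  have hm2 := h.m_lt
  have hν := h.ν_pos
  have hν4 := h.ν_lt
  have h1 : 0 < 1 - ν := by linarith
  have h2 : 0 < 1 + m := by linarith
  have hl := ((mem_triangle_iff h).1 hP).2.1
  have hy : P.2 = m * P.1 - m / (1 + m) := by unfold stableForm at hg; linarith
  have e : lowerForm m ν P * ((1 + m) * (1 - ν)) =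
      m * ((m - 3 * ν) * P.1 * ((1 + m) * (1 - ν)) -
        (m - 3 * ν - 2 * (m * ν) + 2 * ν ^ 2)) := by
    unfold lowerForm
    rw [hy]
    field_simp
    ring
  have hm0 : 0 < m := by linarith
  have i1 : 0 ≤ (m - 3 * ν) * P.1 * ((1 + m) * (1 - ν)) -
      (m - 3 * ν - 2 * (m * ν) + 2 * ν ^ 2) := by
    refine nonneg_of_mul_nonneg_right ?_ hm0
    rw [← e]
    positivity
  have i2 : 0 < m - 3 * ν - 2 * (m * ν) + 2 * ν ^ 2 := by nlinarith
  by_contra! hx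
  have i3 : 0 < (m - 3 * ν) * -P.1 * ((1 + m) * (1 - ν)) := by
    have : 0 < m - 3 * ν := by linarith
    have : 0 < -P.1 := by linarith
    positivity
  linarith

/-- Points of `Δ` on the stable line of `X` are attracted by `X`. -/
theorem pow_of_stableForm_eq_zero (h : Eigen a b m ν) {P : ℝ × ℝ}
    (hP : P ∈ triangle a b hb) (hg : stableForm m P = 0) (n : ℕ) :
    (lozi a b hb ^ n) P = fixedX a b + ν ^ n • (P - fixedX a b) := by
  induction n with
  | zero => simp
  | succ n ih =>
    have hm := h.lt_m
    have h1 : 1 - ν ≠ 0 := by linarith [h.ν_lt]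
    have h2 : 1 + m ≠ 0 := by linarith
    have hy : P.2 = m * P.1 - m / (1 + m) := by unfold stableForm at hg; linarith
    have hx : 0 ≤ ((lozi a b hb ^ n) P).1 := by
      refine fst_nonneg_of_stableForm_eq_zero h (pow_mem_triangle h hP n) ?_
      rw [ih, h.fixedX_eq]
      simp only [stableForm, Prod.fst_add, Prod.snd_add, Prod.smul_fst, Prod.smul_snd, smul_eq_mul,
        Prod.fst_sub, Prod.snd_sub, hy]
      field_simp
      ring
    rw [pow_succ', Equiv.Perm.mul_apply, lozi_apply, abs_of_nonneg hx, ih, h.fixedX_eq, h.a_eq,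
      h.b_eq]
    ext
    · simp only [Prod.fst_add, Prod.snd_add, Prod.smul_fst, Prod.smul_snd, smul_eq_mul,
        Prod.fst_sub, Prod.snd_sub, hy]
      field_simp
      ring
    · simp only [Prod.fst_add, Prod.snd_add, Prod.smul_fst, Prod.smul_snd, smul_eq_mul,
        Prod.fst_sub, Prod.snd_sub, hy]
      field_simp
      ring

/-- On the edge from `L Z` to `L² Z` of `Δ`, `stableForm` is negative. -/
theorem sideForm_pos_of_mem_core (h : Eigen a b m ν) {P : ℝ × ℝ} (hP : P ∈ core a b m hb) :
    0 < sideForm m ν P := by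
  have hm := h.lt_m
  have hν := h.ν_pos
  have hν4 := h.ν_lt
  have h1 : 0 < 1 - ν := by linarith
  have h2 : 0 < 1 + m := by linarith
  have h3 : 0 < m - ν := by linarith
  have h5 : 0 < m - 1 := by linarith
  have h0 : 0 < m := by linarith
  obtain ⟨hΔ, hg⟩ := hP
  obtain ⟨hu, hl, hs⟩ := (mem_triangle_iff h).1 hΔ
  have hκ : 0 < m * (m ^ 2 - 2) - ν * (3 * m ^ 2 - 2) := by
    have i1 := h.sq_lt
    have j0 : 0 < m * ν := by positivity
    have j1 : (m - ν) ^ 2 < m ^ 2 := by nlinarith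
    have i2 : 2 < m ^ 2 := by nlinarith
    have i3 : 4 * m * ν < m ^ 2 - 2 := by nlinarith [mul_pos hν hν]
    nlinarith [mul_lt_mul_of_pos_left i3 h0, mul_pos hν (mul_pos h0 h0)]
  refine lt_of_le_of_ne hs fun hs0 => ?_
  -- `stableForm` in barycentric coordinates; its values at `L Z` and `L² Z` are negative.
  have e1 : stableForm m P =
      (m + ν) / (2 * (1 + m) * ν * (m - 1) * (m - ν)) * sideForm m ν P -
      m * (m + ν) / (2 * (1 + m) * (m - ν) * ν) * lowerForm m ν P -
      m * (m * (m ^ 2 - 2) - ν * (3 * m ^ 2 - 2)) / (2 * (1 + m) * ν * (m - 1) * (m - ν)) *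
        upperForm ν P := by
    unfold stableForm sideForm lowerForm upperForm
    field_simp
    ring
  have e2 : sideForm m ν P + (m - 1) * lowerForm m ν P + m * upperForm ν P =
      2 * (m * ν) * (m - 1) * (m - ν) / (1 - ν) := by
    unfold sideForm lowerForm upperForm
    field_simp
    ring
  have hB : 0 < m * (m + ν) / (2 * (1 + m) * (m - ν) * ν) := by positivity
  have hC : 0 < m * (m * (m ^ 2 - 2) - ν * (3 * m ^ 2 - 2)) /
      (2 * (1 + m) * ν * (m - 1) * (m - ν)) := div_pos (mul_pos h0 hκ) (by positivity)
  have hpos : 0 < 2 * (m * ν) * (m - 1) * (m - ν) / (1 - ν) := by positivity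
  rw [← hs0, mul_zero] at e1
  rw [← hs0] at e2
  have il := mul_nonneg hB.le hl
  have iu := mul_nonneg hC.le hu
  have l0 : lowerForm m ν P = 0 := by
    refine (mul_eq_zero.1 (?_ : _ * lowerForm m ν P = 0)).resolve_left hB.ne'
    linarith
  have u0 : upperForm ν P = 0 := by
    refine (mul_eq_zero.1 (?_ : _ * upperForm ν P = 0)).resolve_left hC.ne'
    linarith
  rw [l0, u0] at e2
  linarith

/-- The boundary of `core` consists of points of the unstable manifold of `X` and of points of the
stable line of `X`. -/
theorem frontier_core (h : Eigen a b m ν) {P : ℝ × ℝ} (hP : P ∈ frontier (core a b m hb)) :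
    P ∈ core a b m hb ∧ (P ∈ unstableX a b hb ∨ stableForm m P = 0) := by
  have hm := h.lt_m
  have hν := h.ν_pos
  have h1 : 0 < 1 - ν := by linarith [h.ν_lt]
  have h2 : 0 < 1 + m := by linarith
  have h3 : 0 < m - ν := by linarith [h.ν_lt]
  have h5 : 0 < m - 1 := by linarith
  have h0 : 0 < m := by linarith
  have hPc : P ∈ core a b m hb := isCompact_core.isClosed.frontier_subset hP
  refine ⟨hPc, ?_⟩
  by_contra! hc
  obtain ⟨hR, hg0⟩ := hc
  obtain ⟨hΔ, hg⟩ := hPc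
  obtain ⟨hu, hl, hs⟩ := (mem_triangle_iff h).1 hΔ
  have hs' := sideForm_pos_of_mem_core h ⟨hΔ, hg⟩
  -- The edge from `X` to `Z` is in the unstable manifold.
  have hu' : 0 < upperForm ν P := by
    refine lt_of_le_of_ne hu fun hu0 => hR ?_
    have e := eq_unstableLine_of_upperForm_eq_zero h hu0.symm
    have hy : P.2 = ν / (1 - ν) - ν * P.1 := by unfold upperForm at hu0; linarith
    rw [e]
    refine unstableLine_mem_unstableX h ⟨?_, ?_⟩
    · have e2 : lowerForm m ν P = 2 * (m - ν) * ν * (1 / (1 - ν) - P.1) := by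
        unfold lowerForm; rw [hy]; field_simp; ring
      have : 0 ≤ 1 / (1 - ν) - P.1 := by
        rw [e2] at hl
        exact nonneg_of_mul_nonneg_right hl (by positivity)
      rw [le_div_iff₀ h0]
      have e3 : 1 / ((1 + m) * (1 - ν)) - P.1 - -(1 / ((1 + m) * (1 - ν))) * m =
        1 / (1 - ν) - P.1 := by field_simp; ring
      linarith
    · have e2 : stableForm m P = (m + ν) * (P.1 - 1 / ((1 + m) * (1 - ν))) := by
        unfold stableForm; rw [hy]; field_simp; ring
      have : 0 ≤ P.1 - 1 / ((1 + m) * (1 - ν)) := by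
        rw [e2] at hg
        exact nonneg_of_mul_nonneg_right hg (by positivity)
      exact (div_nonpos_of_nonpos_of_nonneg (by linarith) h0.le).trans (by positivity)
  -- The edge from `Z` to `L² Z` is the image of a part of the edge from `Z` to `L Z`.
  have hl' : 0 < lowerForm m ν P := by
    refine lt_of_le_of_ne hl fun hl0 => hR ?_
    have ey : lowerForm m ν P - m * upperForm ν P = 2 * (m - ν) * P.2 := by
      unfold lowerForm upperForm; field_simp; ring
    have hy : P.2 ≤ 0 := by
      have : 0 ≤ 2 * (m - ν) * -P.2 := by nlinarith
      linarith [nonneg_of_mul_nonneg_right this (by positivity)]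
    obtain ⟨Q, hQ⟩ : ∃ Q, Q = (lozi a b hb).symm P := ⟨_, rfl⟩
    have hLQ : lozi a b hb Q = P := by rw [hQ, Equiv.apply_symm_apply]
    have hQ2 : b * Q.1 = P.2 := by rw [← hLQ, lozi_apply]
    have hQ1 : Q.1 ≤ 0 := by
      by_contra! hpos
      have := mul_pos hb hpos
      linarith
    have hQu : upperForm ν Q = 0 := by
      have e1 : lowerForm m ν P = m * ν * upperForm ν Q := by
        rw [← hLQ, lozi_apply, abs_of_nonpos hQ1, h.a_eq, h.b_eq]
        unfold lowerForm upperForm; field_simp; ring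
      rw [← hl0] at e1
      rcases mul_eq_zero.1 e1.symm with h' | h'
      · exact absurd h' (by positivity)
      · exact h'
    have hy2 : b * ((1 - m) / (1 - ν)) ≤ P.2 := by
      have := le_of_mem_triangle (hb := hb) 0 (-1) (-(b * ((1 - m) / (1 - ν))))
        (a := a) (b := b) ?_ ?_ ?_ hΔ
      · linarith
      · rw [h.pointZ_eq]
        have : b * ((1 - m) / (1 - ν)) ≤ 0 :=
          mul_nonpos_of_nonneg_of_nonpos hb.le (div_nonpos_of_nonpos_of_nonneg (by linarith) h1.le)
        simpa using this
      · rw [lozi_pointZ h]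
        have i1 : b * ((1 - m) / (1 - ν)) ≤ 0 :=
          mul_nonpos_of_nonneg_of_nonpos hb.le (div_nonpos_of_nonpos_of_nonneg (by linarith) h1.le)
        have i2 : 0 < m * ν / (1 - ν) := by positivity
        simp only []
        linarith
      · rw [lozi_lozi_pointZ h, h.b_eq]
        apply le_of_eq
        simp only []
        ring
    rw [← hLQ, eq_unstableLine_of_upperForm_eq_zero h hQu]
    refine lozi_mem_unstableX h (unstableLine_mem_unstableX h ⟨?_, ?_⟩)
    · rw [le_div_iff₀ h0]
      have : 0 < 1 / ((1 + m) * (1 - ν)) := by positivity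
      nlinarith
    · rw [div_le_iff₀ h0]
      have i1 : (1 - m) / (1 - ν) ≤ Q.1 := by
        rw [← hQ2] at hy2
        exact le_of_mul_le_mul_left hy2 hb
      have e3 : m * (1 / ((1 + m) * (1 - ν))) * m - (1 / ((1 + m) * (1 - ν)) - Q.1) =
        Q.1 - (1 - m) / (1 - ν) := by field_simp; ring
      linarith
  have hopen : IsOpen {Q : ℝ × ℝ | 0 < upperForm ν Q ∧ 0 < lowerForm m ν Q ∧
      0 < sideForm m ν Q ∧ 0 < stableForm m Q} := by
    have c1 : Continuous (upperForm ν) := by unfold upperForm; fun_prop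
    have c2 : Continuous (lowerForm m ν) := by unfold lowerForm; fun_prop
    have c3 : Continuous (sideForm m ν) := by unfold sideForm; fun_prop
    exact (isOpen_lt continuous_const c1).inter ((isOpen_lt continuous_const c2).inter
      ((isOpen_lt continuous_const c3).inter (isOpen_lt continuous_const continuous_stableForm)))
  have hint : P ∈ interior (core a b m hb) := by
    refine mem_interior.2 ⟨_, ?_, hopen, hu', hl', hs', lt_of_le_of_ne hg (Ne.symm hg0)⟩
    rintro Q ⟨q1, q2, q3, q4⟩
    exact ⟨(mem_triangle_iff h).2 ⟨q1.le, q2.le, q3.le⟩, q4.le⟩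
  exact hP.2 hint

/-- Every point of the attractor is a limit of points of the unstable manifold of `X`. Indeed it
lies in `Lⁿ core` for infinitely many `n`; the area of `Lⁿ core` tends to zero, so such a point is
close to its boundary, which consists of points of the unstable manifold of `X` and of points close
to `X`. -/
theorem attractor_subset_closure_unstableX (h : Eigen a b m ν) :
    attractor a b hb ⊆ closure (unstableX a b hb) := by
  intro P hP
  rw [Metric.mem_closure_iff]
  by_contra! hc
  obtain ⟨ε, hε, hfar⟩ := hc
  have hX : fixedX a b ∈ unstableX a b hb := by
    have := unstableLine_mem_unstableX (hb := hb) h (t := 0) ?_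
    · simpa [unstableLine] using this
    · have h1 : 0 < (1 + m) * (1 - ν) := mul_pos (by linarith [h.lt_m]) (by linarith [h.ν_lt])
      have hm : 0 < m := by linarith [h.lt_m]
      exact ⟨by rw [neg_nonpos]; positivity, by positivity⟩
  have hball : 0 < MeasureTheory.volume (Metric.ball P (ε / 2)) :=
    Metric.measure_ball_pos _ _ (by positivity)
  obtain ⟨K, hK⟩ := (isCompact_core (a := a) (b := b) (hb := hb) (m := m)).isBounded.subset_ball
    (fixedX a b)
  have hfin : MeasureTheory.volume (core a b m hb) ≠ ⊤ := isCompact_core.measure_lt_top.ne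
  have hvol : Tendsto (fun n : ℕ => ENNReal.ofReal b ^ n * MeasureTheory.volume (core a b m hb))
      atTop (𝓝 0) := by
    have := ENNReal.Tendsto.mul_const (b := MeasureTheory.volume (core a b m hb))
      (ENNReal.tendsto_pow_atTop_nhds_zero_of_lt_one
        (by rw [← ENNReal.ofReal_one]; exact (ENNReal.ofReal_lt_ofReal_iff one_pos).2 h.b_lt_one :
          ENNReal.ofReal b < 1)) (Or.inr hfin)
    rwa [zero_mul] at this
  have hνpow : Tendsto (fun n : ℕ => ν ^ n * K) atTop (𝓝 0) := by
    have := (tendsto_pow_atTop_nhds_zero_of_lt_one h.ν_pos.le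
      (by linarith [h.ν_lt])).mul_const K
    rwa [zero_mul] at this
  obtain ⟨N, hN⟩ := eventually_atTop.1 ((hvol.eventually_lt_const hball).and
    (hνpow.eventually_lt_const (by positivity : 0 < ε / 2)))
  obtain ⟨n, hn, hcore⟩ := exists_mem_core h hP N
  obtain ⟨hv, hs⟩ := hN n hn
  obtain ⟨S, hS⟩ : ∃ S, S = loziHomeo a b hb n '' core a b m hb := ⟨_, rfl⟩
  have happ : ∀ Q, loziHomeo a b hb n Q = (lozi a b hb ^ n) Q := fun Q => by
    rw [← zpow_natCast]
    rfl
  have hPS : P ∈ S := by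
    rw [hS]
    refine ⟨_, hcore, ?_⟩
    rw [happ, ← zpow_natCast, zpow_apply_zpow_neg]
  have hSc : IsClosed S := by
    rw [hS]
    exact (isCompact_core.image (loziHomeo a b hb n).continuous).isClosed
  have hdisj : ∀ Q ∈ Metric.ball P (ε / 2), Q ∉ frontier S := by
    intro Q hQ hQf
    rw [hS, ← Homeomorph.image_frontier] at hQf
    obtain ⟨W, hW, rfl⟩ := hQf
    rw [happ, Metric.mem_ball, dist_comm] at hQ
    obtain ⟨hWc, hW | hW⟩ := frontier_core h hW
    · have := hfar _ (pow_mem_unstableX h hW n)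
      linarith
    · rw [pow_of_stableForm_eq_zero h hWc.1 hW] at hQ
      have h1 := hfar _ hX
      have h2 : dist (fixedX a b + ν ^ n • (W - fixedX a b)) (fixedX a b) < ε / 2 := by
        rw [dist_eq_norm, add_sub_cancel_left, norm_smul, Real.norm_of_nonneg
          (pow_nonneg h.ν_pos.le n), ← dist_eq_norm]
        refine lt_of_le_of_lt ?_ hs
        have := Metric.mem_ball.1 (hK hWc)
        have := pow_nonneg h.ν_pos.le n
        gcongr
      linarith [dist_triangle P (fixedX a b + ν ^ n • (W - fixedX a b)) (fixedX a b)]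
  have hsub : Metric.ball P (ε / 2) ⊆ interior S := by
    refine (convex_ball P (ε / 2)).isPreconnected.subset_left_of_subset_union isOpen_interior
      hSc.isOpen_compl ?_ ?_ ⟨P, Metric.mem_ball_self (by positivity), ?_⟩
    · exact disjoint_compl_right.mono_left interior_subset
    · intro Q hQ
      by_contra hQ'
      rw [Set.mem_union, not_or, Set.mem_compl_iff, not_not] at hQ'
      refine hdisj Q hQ ?_
      rw [hSc.frontier_eq]
      exact ⟨hQ'.2, hQ'.1⟩
    · by_contra hPi
      refine hdisj P (Metric.mem_ball_self (by positivity)) ?_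
      rw [hSc.frontier_eq]
      exact ⟨hPS, hPi⟩
  have hle := (MeasureTheory.measure_mono (μ := MeasureTheory.volume)
    (hsub.trans interior_subset)).trans (?_ : _ ≤ ENNReal.ofReal b ^ n *
      MeasureTheory.volume (core a b m hb))
  · exact absurd hv (not_lt.2 hle)
  · have : S = (lozi a b hb ^ n) '' core a b m hb := by
      rw [hS]
      exact Set.image_congr fun Q _ => happ Q
    rw [this]
    exact volume_image_pow_le _ _

/-! ### The parametrization of the unstable manifold -/

theorem unstableCurve_eq (h : Eigen a b m ν) {N : ℕ} {t : ℝ}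
    (ht : t / (-m) ^ N ∈ edgeParams m ν) :
    unstableCurve a b hb t = (lozi a b hb ^ N) (unstableLine a b (t / (-m) ^ N)) := by
  unfold unstableCurve
  apply Tendsto.limUnder_eq
  refine tendsto_const_nhds.congr' ?_
  filter_upwards [eventually_ge_atTop N] with n hn
  obtain ⟨k, rfl⟩ := Nat.exists_eq_add_of_le hn
  rw [← pow_unstableLine (hb := hb) h k ht, pow_add, Equiv.Perm.mul_apply, div_div, ← pow_add,
    unstableLine, h.unstableEigenvalue_eq]

/-- The past of the points of a compact arc of the unstable manifold: it is on the unstable line of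
`X`, and on its part in the right half-plane, from some common time on. -/
theorem exists_past (h : Eigen a b m ν) (T : ℝ) :
    ∃ N : ℕ, ∀ n : ℕ, N ≤ n → ∀ t : ℝ, |t| ≤ T → t / (-m) ^ n ∈ edgeParams m ν ∧
      (lozi a b hb ^ (-(n : ℤ))) (unstableCurve a b hb t) = unstableLine a b (t / (-m) ^ n) ∧
      0 < ((lozi a b hb ^ (-(n : ℤ))) (unstableCurve a b hb t)).1 := by
  have hm := h.lt_m
  have h0 : 0 < m := by linarith
  have h1 : 0 < (1 + m) * (1 - ν) := mul_pos (by linarith) (by linarith [h.ν_lt])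
  have hc : 0 < 1 / ((1 + m) * (1 - ν)) := by positivity
  obtain ⟨N, hN⟩ := pow_unbounded_of_one_lt (T * m / (1 / ((1 + m) * (1 - ν))))
    (by linarith : 1 < m)
  refine ⟨N, fun n hn t ht => ?_⟩
  have hsmall : |t / (-m) ^ n| * m < 1 / ((1 + m) * (1 - ν)) := by
    have hpow : m ^ N ≤ m ^ n := pow_le_pow_right₀ (by linarith) hn
    rw [div_lt_iff₀ hc] at hN
    rw [abs_div, abs_pow, abs_neg, abs_of_pos h0, div_mul_eq_mul_div, div_lt_iff₀ (by positivity)]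
    nlinarith
  have hmem : t / (-m) ^ n ∈ edgeParams m ν := by
    have i0 := abs_nonneg (t / (-m) ^ n)
    have i1 : |t / (-m) ^ n| ≤ 1 / ((1 + m) * (1 - ν)) := by nlinarith
    have i2 := abs_le.1 i1
    exact ⟨i2.1, i2.2.trans (by nlinarith)⟩
  have heq : (lozi a b hb ^ (-(n : ℤ))) (unstableCurve a b hb t) =
      unstableLine a b (t / (-m) ^ n) := by
    rw [unstableCurve_eq h hmem, ← zpow_natCast, zpow_neg_apply_zpow]
  refine ⟨hmem, heq, ?_⟩
  rw [heq, unstableLine_eq h]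
  have := (le_abs_self (t / (-m) ^ n))
  simp only []
  nlinarith

theorem unstableCurve_mem_unstableX (h : Eigen a b m ν) (t : ℝ) :
    unstableCurve a b hb t ∈ unstableX a b hb := by
  rw [mem_unstableX_iff]
  obtain ⟨N, hN⟩ := exists_past (hb := hb) h |t|
  refine (tendsto_unstableLine_div_pow h t).congr' ?_
  filter_upwards [eventually_ge_atTop N] with n hn
  exact (hN n hn t le_rfl).2.1.symm

theorem unstableCurve_mem_attractor (h : Eigen a b m ν) (t : ℝ) :
    unstableCurve a b hb t ∈ attractor a b hb := by
  obtain ⟨N, hN⟩ := exists_past (hb := hb) h |t|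
  rw [mem_attractor_iff]
  intro n
  obtain ⟨h1, h2, -⟩ := hN (N + n) (by omega) t le_rfl
  have e : (-(n : ℤ)) = (N : ℤ) + -((N + n : ℕ) : ℤ) := by push_cast; ring
  rw [e, zpow_add_apply, h2, zpow_natCast]
  exact pow_mem_triangle h (unstableLine_mem_triangle h h1) N

theorem upperForm_lozi (h : Eigen a b m ν) {P : ℝ × ℝ} (hP : 0 ≤ P.1) :
    upperForm ν (lozi a b hb P) = ν * upperForm ν P := by
  have h2 : 1 - ν ≠ 0 := by linarith [h.ν_lt]
  rw [lozi_apply, abs_of_nonneg hP, h.a_eq, h.b_eq]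
  unfold upperForm
  field_simp
  ring

/-- The curve runs through all of the unstable manifold: a backward orbit converging to `X` is
eventually in the right half-plane, where the backward iterates multiply `upperForm` by `ν⁻¹ > 1`,
so it is eventually on the unstable line. -/
theorem exists_unstableCurve_eq (h : Eigen a b m ν) {P : ℝ × ℝ} (hP : P ∈ unstableX a b hb) :
    ∃ t, unstableCurve a b hb t = P := by
  have hm := h.lt_m
  have h0 : 0 < m := by linarith
  have h1 : 0 < (1 + m) * (1 - ν) := mul_pos (by linarith) (by linarith [h.ν_lt])
  have hc : 0 < 1 / ((1 + m) * (1 - ν)) := by positivity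
  rw [mem_unstableX_iff] at hP
  have hfst : Tendsto (fun n : ℕ => ((lozi a b hb ^ (-(n : ℤ))) P).1) atTop
      (𝓝 (1 / ((1 + m) * (1 - ν)))) := by
    have := (continuous_fst.tendsto (fixedX a b)).comp hP
    rwa [h.fixedX_eq] at this
  obtain ⟨N, hN⟩ := eventually_atTop.1 ((hfst.eventually_const_lt hc).and
    (hfst.eventually_lt_const (by linarith : 1 / ((1 + m) * (1 - ν)) <
      2 * (1 / ((1 + m) * (1 - ν))))))
  have hu : ∀ k : ℕ, ν ^ k * upperForm ν ((lozi a b hb ^ (-((N + k : ℕ) : ℤ))) P) =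
      upperForm ν ((lozi a b hb ^ (-(N : ℤ))) P) := by
    intro k
    induction k with
    | zero => simp
    | succ k ih =>
      have e : (-((N + k : ℕ) : ℤ)) = -((N + (k + 1) : ℕ) : ℤ) + 1 := by push_cast; ring
      rw [← ih, e, zpow_succ_apply, upperForm_lozi h (hN (N + (k + 1)) (by omega)).1.le]
      ring
  have hu0 : upperForm ν ((lozi a b hb ^ (-(N : ℤ))) P) = 0 := by
    have c1 : Continuous (upperForm ν) := by unfold upperForm; fun_prop
    have l1 := ((c1.tendsto _).comp hP).comp (tendsto_add_atTop_nat N)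
    have l2 := (tendsto_pow_atTop_nhds_zero_of_lt_one h.ν_pos.le
      (by linarith [h.ν_lt])).mul l1
    rw [zero_mul] at l2
    refine tendsto_nhds_unique (tendsto_const_nhds.congr fun k => ?_) l2
    rw [← hu k, add_comm N k]
    rfl
  have hline := eq_unstableLine_of_upperForm_eq_zero h hu0
  obtain ⟨u, hu'⟩ : ∃ u, u = (1 / ((1 + m) * (1 - ν)) - ((lozi a b hb ^ (-(N : ℤ))) P).1) / m :=
    ⟨_, rfl⟩
  rw [← hu'] at hline
  have hmN : (-m) ^ N ≠ 0 := pow_ne_zero _ (by linarith)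
  refine ⟨u * (-m) ^ N, ?_⟩
  have hdiv : u * (-m) ^ N / (-m) ^ N = u := by field_simp
  rw [unstableCurve_eq h (N := N), hdiv, ← hline, ← zpow_natCast, zpow_apply_zpow_neg]
  rw [hdiv, hu']
  obtain ⟨x1, x2⟩ := hN N le_rfl
  constructor
  · rw [le_div_iff₀ h0]
    nlinarith
  · rw [div_le_iff₀ h0]
    generalize 1 / ((1 + m) * (1 - ν)) = c at hc ⊢
    have i1 : 1 ≤ m * m := by nlinarith
    have i2 := mul_le_mul_of_nonneg_left i1 hc.le
    linarith

theorem lipschitzWith_lozi (ha : 0 < a) :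
    LipschitzWith (Real.toNNReal (1 + a + b)) (lozi a b hb) := by
  refine LipschitzWith.of_dist_le_mul fun P Q => ?_
  rw [Real.coe_toNNReal _ (by positivity)]
  have d1 : |P.1 - Q.1| ≤ dist P Q := by
    rw [Prod.dist_eq, ← Real.dist_eq]
    exact le_max_left _ _
  have d2 : |P.2 - Q.2| ≤ dist P Q := by
    rw [Prod.dist_eq, ← Real.dist_eq]
    exact le_max_right _ _
  have d0 : 0 ≤ dist P Q := dist_nonneg
  have d3 := mul_le_mul_of_nonneg_left d1 ha.le
  have d4 := mul_le_mul_of_nonneg_left d1 hb.le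
  have d5 : |a * (|P.1| - |Q.1|)| ≤ a * |P.1 - Q.1| := by
    rw [abs_mul, abs_of_pos ha]
    exact mul_le_mul_of_nonneg_left (abs_abs_sub_abs_le _ _) ha.le
  have hbd := mul_nonneg hb.le d0
  have had := mul_nonneg ha.le d0
  refine max_le ?_ ?_
  · rw [lozi_apply, lozi_apply, Real.dist_eq]
    have e : (1 + P.2 - a * |P.1|) - (1 + Q.2 - a * |Q.1|) =
      (P.2 - Q.2) - a * (|P.1| - |Q.1|) := by ring
    simp only [e]
    refine (abs_sub _ _).trans ?_
    linarith
  · rw [lozi_apply, lozi_apply, Real.dist_eq]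
    simp only [← mul_sub, abs_mul, abs_of_pos hb]
    linarith

theorem exists_lipschitzOnWith_unstableCurve (h : Eigen a b m ν) (T : ℝ) :
    ∃ C, LipschitzOnWith C (unstableCurve a b hb) (Set.Icc (-T) T) := by
  have ha : 0 < a := by linarith [h.b_lt_a_sub_one]
  obtain ⟨N, hN⟩ := exists_past (hb := hb) h T
  have hline : ∃ C, LipschitzWith C fun t : ℝ => unstableLine a b (t / (-m) ^ N) := by
    refine ⟨‖((-m) ^ N)⁻¹ • (unstableEigenvalue a b, b)‖₊, LipschitzWith.of_dist_le_mul ?_⟩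
    intro s t
    have e : unstableLine a b (s / (-m) ^ N) - unstableLine a b (t / (-m) ^ N) =
        (s - t) • (((-m) ^ N)⁻¹ • (unstableEigenvalue a b, b)) := by
      unfold unstableLine
      rw [smul_smul, ← div_eq_mul_inv, add_sub_add_left_eq_sub, ← sub_smul, sub_div]
    rw [dist_eq_norm, e, norm_smul, coe_nnnorm, mul_comm, dist_eq_norm]
  obtain ⟨C, hC⟩ := hline
  have hL : LipschitzWith (Real.toNNReal (1 + a + b) ^ N) ⇑(lozi a b hb ^ N) := by
    rw [Equiv.Perm.coe_pow]
    exact (lipschitzWith_lozi ha).iterate N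
  refine ⟨Real.toNNReal (1 + a + b) ^ N * C, fun s hs t ht => ?_⟩
  rw [unstableCurve_eq h (hN N le_rfl s (abs_le.2 hs)).1,
    unstableCurve_eq h (hN N le_rfl t (abs_le.2 ht)).1]
  exact (hL.comp hC) s t

theorem continuous_unstableCurve (h : Eigen a b m ν) : Continuous (unstableCurve a b hb) := by
  rw [continuous_iff_continuousAt]
  intro t
  obtain ⟨C, hC⟩ := exists_lipschitzOnWith_unstableCurve (hb := hb) h (|t| + 1)
  refine hC.continuousOn.continuousAt (Icc_mem_nhds ?_ ?_)
  · linarith [neg_abs_le t]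
  · linarith [le_abs_self t]

/-- Neighbouring parameters give points that are close along the unstable manifold. -/
theorem eventually_mem_arcBall (h : Eigen a b m ν) (t₀ : ℝ) {ε : ℝ} (hε : 0 < ε) :
    ∀ᶠ s in 𝓝 t₀, unstableCurve a b hb s ∈ arcBall a b hb (unstableCurve a b hb t₀) ε := by
  obtain ⟨C, hC⟩ := exists_lipschitzOnWith_unstableCurve (hb := hb) h (|t₀| + 1)
  obtain ⟨D, hD⟩ : ∃ D, LipschitzWith D (WithLp.toLp 2 : ℝ × ℝ → WithLp 2 (ℝ × ℝ)) :=
    ⟨_, WithLp.prod_lipschitzWith_toLp 2 ℝ ℝ⟩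
  have hDC : LipschitzOnWith (D * C) (fun u => WithLp.toLp 2 (unstableCurve a b hb u))
      (Set.Icc (-(|t₀| + 1)) (|t₀| + 1)) := hD.comp_lipschitzOnWith hC
  have hle : ∀ s, |s - t₀| < 1 →
      arcLength a b hb t₀ s ≤ (D * C : NNReal) * ENNReal.ofReal |s - t₀| := by
    intro s hs
    have i1 := abs_lt.1 hs
    have hsub : Set.uIcc t₀ s ⊆ Set.Icc (-(|t₀| + 1)) (|t₀| + 1) :=
      Set.uIcc_subset_Icc ⟨by linarith [neg_abs_le t₀], by linarith [le_abs_self t₀]⟩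
        ⟨by linarith [neg_abs_le t₀], by linarith [le_abs_self t₀]⟩
    have h1 := (hDC.mono hsub).comp_eVariationOn_le (g := id) (s := Set.uIcc t₀ s)
      (Set.mapsTo_id _)
    refine h1.trans ?_
    gcongr
    have h2 := (monotone_id (α := ℝ)).monotoneOn (Set.uIcc t₀ s) |>.eVariationOn_eq
      (a := min t₀ s) (b := max t₀ s) (by simp [Set.uIcc]) (by simp [Set.uIcc])
    rw [← Set.uIcc, Set.inter_self] at h2
    rw [h2, id, id, max_sub_min_eq_abs]
  have hlim : Tendsto (fun s => (D * C : NNReal) * ENNReal.ofReal |s - t₀|) (𝓝 t₀) (𝓝 0) := by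
    have h1 : Tendsto (fun s => ENNReal.ofReal |s - t₀|) (𝓝 t₀) (𝓝 0) := by
      have : Continuous fun s => ENNReal.ofReal |s - t₀| :=
        ENNReal.continuous_ofReal.comp (by fun_prop)
      simpa using this.tendsto t₀
    have := ENNReal.Tendsto.const_mul (a := ((D * C : NNReal) : ENNReal)) h1
      (Or.inr ENNReal.coe_ne_top)
    rwa [mul_zero] at this
  have hball : ∀ᶠ s in 𝓝 t₀, |s - t₀| < 1 := by
    filter_upwards [Metric.ball_mem_nhds t₀ one_pos] with s hs
    rwa [Metric.mem_ball, Real.dist_eq] at hs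
  filter_upwards [hlim.eventually_lt_const (ENNReal.ofReal_pos.2 hε), hball] with s hs hs1
  exact ⟨t₀, s, rfl, rfl, (hle s hs1).trans_lt hs⟩

/-! ### Crossings of the vertical axis along the unstable manifold -/

/-- The first coordinate of the `n`-th iterate of the point of the unstable manifold with
parameter `t`. -/
def curveFst (a b : ℝ) (hb : 0 < b) (n : ℤ) (t : ℝ) : ℝ :=
  ((lozi a b hb ^ n) (unstableCurve a b hb t)).1

theorem continuous_curveFst (h : Eigen a b m ν) (n : ℤ) : Continuous (curveFst a b hb n) :=
  continuous_fst.comp ((continuous_lozi_zpow n).comp (continuous_unstableCurve h))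

theorem exists_curveFst_pos (h : Eigen a b m ν) (T : ℝ) :
    ∃ N : ℕ, ∀ n : ℤ, n ≤ -(N : ℤ) → ∀ t : ℝ, |t| ≤ T → 0 < curveFst a b hb n t := by
  obtain ⟨N, hN⟩ := exists_past (hb := hb) h T
  refine ⟨N, fun n hn t ht => ?_⟩
  obtain ⟨k, rfl⟩ : ∃ k : ℕ, n = -(k : ℤ) := ⟨(-n).toNat, by omega⟩
  exact (hN k (by omega) t ht).2.2

/-- As long as two points of the unstable manifold have been in the same half-planes, the first
coordinates of their iterates are at increasing distances. -/
theorem curveFst_ne (h : Eigen a b m ν) {s t : ℝ} (hst : s ≠ t) {N : ℤ}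
    (hsame : ∀ n < N, 0 ≤ curveFst a b hb n s * curveFst a b hb n t) :
    curveFst a b hb N s ≠ curveFst a b hb N t := by
  have hm := h.lt_m
  have h0 : 0 < m := by linarith
  have hab := h.b_lt_a_sub_one
  obtain ⟨K, hK⟩ := exists_past (hb := hb) h (max |s| |t|)
  obtain ⟨k, hkK, hkN⟩ : ∃ k : ℕ, K ≤ k ∧ -(k : ℤ) ≤ N := ⟨max K (-N).toNat, by omega, by omega⟩
  have hd : ∀ n : ℕ, K ≤ n → |curveFst a b hb (-(n : ℤ)) s - curveFst a b hb (-(n : ℤ)) t| =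
      m * (|s - t| / m ^ n) := by
    intro n hn
    rw [curveFst, curveFst, (hK n hn s (le_max_left _ _)).2.1, (hK n hn t (le_max_right _ _)).2.1,
      unstableLine_eq h, unstableLine_eq h]
    simp only []
    rw [sub_sub_sub_cancel_left, ← sub_mul, ← sub_div, abs_mul, abs_div, abs_pow, abs_neg,
      abs_of_pos h0, abs_sub_comm t s, mul_comm]
  have key : ∀ M : ℤ, -(k : ℤ) ≤ M → M ≤ N →
      0 < |curveFst a b hb (M - 1) s - curveFst a b hb (M - 1) t| ∧
      |curveFst a b hb (M - 1) s - curveFst a b hb (M - 1) t| ≤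
        |curveFst a b hb M s - curveFst a b hb M t| := by
    intro M hM
    induction M, hM using Int.leInduction with
    | base =>
      intro _
      have e : (-(k : ℤ) - 1) = -((k + 1 : ℕ) : ℤ) := by push_cast; ring
      rw [e, hd (k + 1) (by omega), hd k hkK]
      have : 0 < |s - t| := abs_pos.2 (sub_ne_zero.2 hst)
      refine ⟨by positivity, ?_⟩
      gcongr
      · linarith
      · omega
    | succ M hM ih =>
      intro hMN
      obtain ⟨i1, i2⟩ := ih (by omega)
      rw [add_sub_cancel_right]
      refine ⟨i1.trans_le i2, ?_⟩
      have := mul_abs_sub_le (a := a) (hb := hb) (by linarith) (hsame M (by omega))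
      simp only [curveFst] at i1 i2 ⊢
      nlinarith
  intro heq
  obtain ⟨i1, i2⟩ := key N hkN le_rfl
  rw [heq, sub_self, abs_zero] at i2
  linarith

theorem mul_pos_of_forall_ne_zero {f : ℝ → ℝ} (hf : Continuous f) {S : Set ℝ}
    (hS : IsPreconnected S) (h0 : ∀ t ∈ S, f t ≠ 0) {s t : ℝ} (hs : s ∈ S) (ht : t ∈ S) :
    0 < f s * f t := by
  by_contra! hc
  have hz : (0 : ℝ) ∈ f '' S := by
    rcases mul_nonpos_iff.1 hc with ⟨h1, h2⟩ | ⟨h1, h2⟩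
    · exact hS.intermediate_value ht hs hf.continuousOn ⟨h2, h1⟩
    · exact hS.intermediate_value hs ht hf.continuousOn ⟨h1, h2⟩
  obtain ⟨u, hu, hu0⟩ := hz
  exact h0 u hu hu0

/-- If no iterate before time `n` meets the vertical axis on an open arc, then by `curveFst_ne` the
`n`-th one meets it at most once there, and the arc can be shortened to avoid that point. -/
theorem exists_Ioo_curveFst_ne_zero (h : Eigen a b m ν) {u v : ℝ} (huv : u < v) (N : ℤ) :
    ∃ u' v', u' < v' ∧ Set.Ioo u' v' ⊆ Set.Ioo u v ∧
      ∀ n ≤ N, ∀ t ∈ Set.Ioo u' v', curveFst a b hb n t ≠ 0 := by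
  obtain ⟨K, hK⟩ := exists_curveFst_pos (hb := hb) h (max |u| |v|)
  have key : ∀ M : ℤ, -(K : ℤ) ≤ M → ∃ u' v', u' < v' ∧ Set.Ioo u' v' ⊆ Set.Ioo u v ∧
      ∀ n ≤ M, ∀ t ∈ Set.Ioo u' v', curveFst a b hb n t ≠ 0 := by
    intro M hM
    induction M, hM using Int.leInduction with
    | base =>
      refine ⟨u, v, huv, subset_rfl, fun n hn t ht => (hK n hn t ?_).ne'⟩
      exact abs_le_max_abs_abs ht.1.le ht.2.le
    | succ M hM ih =>
      obtain ⟨u', v', huv', hsub, hne⟩ := ih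
      by_cases hz : ∃ t₀ ∈ Set.Ioo u' v', curveFst a b hb (M + 1) t₀ = 0
      · obtain ⟨t₀, ht₀, hz⟩ := hz
        refine ⟨u', t₀, ht₀.1, (Set.Ioo_subset_Ioo_right ht₀.2.le).trans hsub, ?_⟩
        intro n hn t ht
        have ht' : t ∈ Set.Ioo u' v' := ⟨ht.1, ht.2.trans ht₀.2⟩
        rcases (by omega : n ≤ M ∨ n = M + 1) with hn' | rfl
        · exact hne n hn' t ht'
        · rw [← hz]
          refine curveFst_ne h ht.2.ne fun j hj => ?_
          exact (mul_pos_of_forall_ne_zero (continuous_curveFst h j) isPreconnected_Ioo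
            (hne j (by omega)) ht' ht₀).le
      · push Not at hz
        refine ⟨u', v', huv', hsub, fun n hn t ht => ?_⟩
        rcases (by omega : n ≤ M ∨ n = M + 1) with hn' | rfl
        · exact hne n hn' t ht
        · exact hz t ht
  obtain ⟨u', v', h1, h2, h3⟩ := key (max (-(K : ℤ)) N) (le_max_left _ _)
  exact ⟨u', v', h1, h2, fun n hn => h3 n (hn.trans (le_max_right _ _))⟩

theorem dense_forall_curveFst_ne_zero (h : Eigen a b m ν) :
    Dense {t | ∀ n, curveFst a b hb n t ≠ 0} := by
  have e : {t | ∀ n, curveFst a b hb n t ≠ 0} = ⋂ n, {t | curveFst a b hb n t ≠ 0} := by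
    ext t
    simp
  rw [e]
  refine dense_iInter_of_isOpen (fun n => ?_) fun n => ?_
  · exact isOpen_ne_fun (continuous_curveFst h n) continuous_const
  · rw [dense_iff_inter_open]
    rintro U hU ⟨t, ht⟩
    obtain ⟨u, v, htuv, hsub⟩ := mem_nhds_iff_exists_Ioo_subset.1 (hU.mem_nhds ht)
    obtain ⟨u', v', huv', hsub', hne⟩ :=
      exists_Ioo_curveFst_ne_zero (hb := hb) h (htuv.1.trans htuv.2) n
    obtain ⟨t', ht'⟩ := Set.nonempty_Ioo.2 huv'
    exact ⟨t', hsub (hsub' ht'), hne n le_rfl t' ht'⟩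

/-- At its first visit to the vertical axis, an arc of the unstable manifold crosses the axis. -/
theorem mem_closure_of_first_zero (h : Eigen a b m ν) {t₀ : ℝ} {l : ℤ}
    (hl : curveFst a b hb l t₀ = 0) (hfirst : ∀ n < l, curveFst a b hb n t₀ ≠ 0) :
    t₀ ∈ closure {s | 0 < curveFst a b hb l s} ∧ t₀ ∈ closure {s | curveFst a b hb l s < 0} := by
  obtain ⟨K, hK⟩ := exists_curveFst_pos (hb := hb) h (|t₀| + 1)
  have hnear : ∀ᶠ s in 𝓝 t₀, |s| ≤ |t₀| + 1 := by
    have : Continuous fun s : ℝ => |s| := by fun_prop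
    exact (this.tendsto t₀).eventually_le_const (by linarith)
  have hfin : ∀ᶠ s in 𝓝 t₀, ∀ n ∈ Set.Ioo (-(K : ℤ)) l,
      0 < curveFst a b hb n s * curveFst a b hb n t₀ := by
    rw [eventually_all_finite (Set.finite_Ioo _ _)]
    intro n hn
    have c := (continuous_curveFst (hb := hb) h n).mul
      (continuous_const (y := curveFst a b hb n t₀))
    exact (c.tendsto t₀).eventually_const_lt (mul_self_pos.2 (hfirst n hn.2))
  obtain ⟨u, v, htuv, hsub⟩ := mem_nhds_iff_exists_Ioo_subset.1 (hnear.and hfin)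
  have hpos : ∀ s ∈ Set.Ioo u v, ∀ n < l, 0 < curveFst a b hb n s * curveFst a b hb n t₀ := by
    intro s hs n hn
    obtain ⟨h1, h2⟩ := hsub hs
    rcases le_or_gt n (-(K : ℤ)) with hnK | hnK
    · exact mul_pos (hK n hnK s h1) (hK n hnK t₀ (by linarith))
    · exact h2 n ⟨hnK, hn⟩
  have hinj : Set.InjOn (curveFst a b hb l) (Set.Ioo u v) := by
    intro s hs t ht heq
    by_contra hst
    refine curveFst_ne h hst (fun n hn => ?_) heq
    have h1 := mul_pos (hpos s hs n hn) (hpos t ht n hn)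
    have h2 : 0 < curveFst a b hb n t₀ ^ 2 := by
      have := hfirst n hn
      positivity
    refine (pos_of_mul_pos_left (?_ : 0 < _ * curveFst a b hb n t₀ ^ 2) h2.le).le
    calc 0 < _ := h1
      _ = _ := by ring
  have hleft : t₀ ∈ closure (Set.Ioo u t₀) := by
    rw [closure_Ioo htuv.1.ne]
    exact Set.right_mem_Icc.2 htuv.1.le
  have hright : t₀ ∈ closure (Set.Ioo t₀ v) := by
    rw [closure_Ioo htuv.2.ne]
    exact Set.left_mem_Icc.2 htuv.2.le
  have sl : ∀ s ∈ Set.Ioo u t₀, s ∈ Set.Ioo u v := fun s hs => ⟨hs.1, hs.2.trans htuv.2⟩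
  have sr : ∀ s ∈ Set.Ioo t₀ v, s ∈ Set.Ioo u v := fun s hs => ⟨htuv.1.trans hs.1, hs.2⟩
  rcases ContinuousOn.strictMonoOn_of_injOn_Ioo (htuv.1.trans htuv.2)
    (continuous_curveFst h l).continuousOn hinj with hmono | hanti
  · refine ⟨closure_mono (fun s hs => ?_) hright, closure_mono (fun s hs => ?_) hleft⟩
    · have := hmono htuv (sr s hs) hs.1
      rwa [hl] at this
    · have := hmono (sl s hs) htuv hs.2
      rwa [hl] at this
  · refine ⟨closure_mono (fun s hs => ?_) hleft, closure_mono (fun s hs => ?_) hright⟩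
    · have := hanti (sl s hs) htuv hs.2
      rwa [hl] at this
    · have := hanti htuv (sr s hs) hs.1
      rwa [hl] at this

/-! ### Itineraries -/

theorem isClosed_isItinerary :
    IsClosed {q : (ℝ × ℝ) × (ℤ → Bool) | IsItinerary a b hb q.1 q.2} := by
  have e : {q : (ℝ × ℝ) × (ℤ → Bool) | IsItinerary a b hb q.1 q.2} =
      ⋂ n : ℤ, ({q | q.2 n = true → 0 ≤ ((lozi a b hb ^ n) q.1).1} ∩
        {q | q.2 n = false → ((lozi a b hb ^ n) q.1).1 ≤ 0}) := by
    ext q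
    simp [IsItinerary]
  rw [e]
  refine isClosed_iInter fun n => ?_
  have hq : Continuous fun q : (ℝ × ℝ) × (ℤ → Bool) => q.2 n := by fun_prop
  have hs : ∀ c : Bool, IsOpen {q : (ℝ × ℝ) × (ℤ → Bool) | q.2 n = c} := fun c =>
    (isOpen_discrete {c}).preimage hq
  have hx : Continuous fun q : (ℝ × ℝ) × (ℤ → Bool) => ((lozi a b hb ^ n) q.1).1 :=
    continuous_fst.comp ((continuous_lozi_zpow n).comp continuous_fst)
  exact (isClosed_imp (hs true) (isClosed_le continuous_const hx)).inter
    (isClosed_imp (hs false) (isClosed_le hx continuous_const))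

/-- The graph of the coding over a closed set of sequences is compact. -/
theorem isCompact_coding_graph {C : Set (ℤ → Bool)} (hC : IsClosed C) :
    IsCompact ((attractor a b hb ×ˢ C) ∩
      {q : (ℝ × ℝ) × (ℤ → Bool) | IsItinerary a b hb q.1 q.2}) :=
  (isCompact_attractor.prod hC.isCompact).inter_right isClosed_isItinerary

theorem isClosed_admissible : IsClosed (admissible a b hb) := by
  have e : admissible a b hb = Prod.snd '' ((attractor a b hb ×ˢ Set.univ) ∩
      {q : (ℝ × ℝ) × (ℤ → Bool) | IsItinerary a b hb q.1 q.2}) := by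
    ext p
    constructor
    · rintro ⟨P, hP, hp⟩
      exact ⟨(P, p), ⟨⟨hP, trivial⟩, hp⟩, rfl⟩
    · rintro ⟨⟨P, q⟩, ⟨⟨hP, -⟩, hp⟩, rfl⟩
      exact ⟨P, hP, hp⟩
  rw [e]
  exact ((isCompact_coding_graph isClosed_univ).image continuous_snd).isClosed

theorem coding_spec {p : ℤ → Bool} (hp : p ∈ admissible a b hb) :
    coding a b hb p ∈ attractor a b hb ∧ IsItinerary a b hb (coding a b hb p) p :=
  Classical.epsilon_spec hp

theorem coding_eq (h : Eigen a b m ν) {P : ℝ × ℝ} {p : ℤ → Bool} (hP : P ∈ attractor a b hb)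
    (hp : IsItinerary a b hb P p) : coding a b hb p = P := by
  obtain ⟨h1, h2⟩ := coding_spec ⟨P, hP, hp⟩
  exact h2.unique h h1 hP hp

theorem exists_isItinerary (P : ℝ × ℝ) : ∃ p, IsItinerary a b hb P p := by
  refine ⟨fun n => decide (0 ≤ ((lozi a b hb ^ n) P).1), fun n => ⟨fun hn => ?_, fun hn => ?_⟩⟩
  · exact of_decide_eq_true hn
  · exact (not_le.1 (of_decide_eq_false hn)).le

theorem essentialAdmissible_subset (h : Eigen a b m ν) :
    essentialAdmissible a b hb ⊆ admissible a b hb := by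
  refine closure_minimal ?_ isClosed_admissible
  rintro p ⟨P, hP, hp, -⟩
  obtain ⟨t, rfl⟩ := exists_unstableCurve_eq h hP
  exact ⟨_, unstableCurve_mem_attractor h t, hp⟩

/-- The points of the unstable manifold that never visit the vertical axis are dense in the
attractor, and their itineraries are trivially essential. -/
theorem attractor_subset_coding_image (h : Eigen a b m ν) :
    attractor a b hb ⊆ coding a b hb '' essentialAdmissible a b hb := by
  have e : coding a b hb '' essentialAdmissible a b hb =
      Prod.fst '' ((attractor a b hb ×ˢ essentialAdmissible a b hb) ∩
        {q : (ℝ × ℝ) × (ℤ → Bool) | IsItinerary a b hb q.1 q.2}) := by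
    ext P
    constructor
    · rintro ⟨p, hp, rfl⟩
      obtain ⟨h1, h2⟩ := coding_spec (essentialAdmissible_subset h hp)
      exact ⟨(_, p), ⟨⟨h1, hp⟩, h2⟩, rfl⟩
    · rintro ⟨⟨Q, p⟩, ⟨⟨hQ, hp⟩, hQp⟩, rfl⟩
      exact ⟨p, hp, coding_eq h hQ hQp⟩
  have hclosed : IsClosed (coding a b hb '' essentialAdmissible a b hb) := by
    rw [e]
    exact ((isCompact_coding_graph isClosed_closure).image continuous_fst).isClosed
  refine (attractor_subset_closure_unstableX h).trans (closure_minimal ?_ hclosed)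
  intro P hP
  obtain ⟨t, rfl⟩ := exists_unstableCurve_eq h hP
  have ht : t ∈ closure {t | ∀ n, curveFst a b hb n t ≠ 0} := dense_forall_curveFst_ne_zero h t
  have himg : unstableCurve a b hb t ∈
      closure (unstableCurve a b hb '' {t | ∀ n, curveFst a b hb n t ≠ 0}) :=
    image_closure_subset_closure_image (continuous_unstableCurve h) ⟨t, ht, rfl⟩
  refine closure_minimal ?_ hclosed himg
  rintro _ ⟨s, hs, rfl⟩
  obtain ⟨p, hp⟩ := exists_isItinerary (hb := hb) (a := a) (unstableCurve a b hb s)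
  refine ⟨p, subset_closure ⟨_, unstableCurve_mem_unstableX h s, hp, fun l hl _ => ?_⟩,
    coding_eq h (unstableCurve_mem_attractor h s) hp⟩
  exact absurd hl (hs l)

/-- An essential itinerary `p` of a point `P` of the unstable manifold is a limit of itineraries of
nearby points of the curve. These are the points on the side of `P` on which the first visit of the
orbit of `P` to the vertical axis is resolved in the way that `p` prescribes; later visits are then
resolved correctly because `p` is essential. For each fixed time, points close enough to `P` are
strictly on the side that `p` prescribes, so their itineraries leave no choice there. -/
theorem exists_filter_of_mem_essentialR (h : Eigen a b m ν) {p : ℤ → Bool}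
    (hp : p ∈ essentialR a b hb) :
    ∃ 𝓕 : Filter ℝ, 𝓕.NeBot ∧ ∀ n, ∀ᶠ s in 𝓕,
      (p n = true → 0 < curveFst a b hb n s) ∧ (p n = false → curveFst a b hb n s < 0) := by
  obtain ⟨P, hP, hpP, hess⟩ := hp
  obtain ⟨t₀, rfl⟩ := exists_unstableCurve_eq h hP
  have hne : ∀ n, curveFst a b hb n t₀ ≠ 0 → ∀ᶠ s in 𝓝 t₀,
      (p n = true → 0 < curveFst a b hb n s) ∧ (p n = false → curveFst a b hb n s < 0) := by
    intro n hn
    have c := (continuous_curveFst (hb := hb) h n).tendsto t₀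
    cases hpn : p n
    · have : curveFst a b hb n t₀ < 0 := lt_of_le_of_ne ((hpP n).2 hpn) hn
      filter_upwards [c.eventually_lt_const this] with s hs
      simpa using hs
    · have : 0 < curveFst a b hb n t₀ := lt_of_le_of_ne ((hpP n).1 hpn) (Ne.symm hn)
      filter_upwards [c.eventually_const_lt this] with s hs
      simpa using hs
  by_cases hz : ∃ l, curveFst a b hb l t₀ = 0
  · obtain ⟨K, hK⟩ := exists_curveFst_pos (hb := hb) h |t₀|
    obtain ⟨l, hl, hmin⟩ := Int.exists_least_of_bdd (P := fun l => curveFst a b hb l t₀ = 0)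
      ⟨-(K : ℤ), fun z hz => by
        by_contra! hlt
        exact (hK z hlt.le t₀ le_rfl).ne' hz⟩ hz
    obtain ⟨c1, c2⟩ := mem_closure_of_first_zero h hl fun n hn h0 =>
      absurd (hmin n h0) (not_le.2 hn)
    obtain ⟨S, hS⟩ : ∃ S : Set ℝ, S = {s | (p l = true → 0 < curveFst a b hb l s) ∧
      (p l = false → curveFst a b hb l s < 0)} := ⟨_, rfl⟩
    have hcl : t₀ ∈ closure S := by
      rw [hS]
      cases hpl : p l
      · simpa using c2
      · simpa using c1
    refine ⟨𝓝[S] t₀, mem_closure_iff_nhdsWithin_neBot.1 hcl, fun n => ?_⟩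
    by_cases hn : curveFst a b hb n t₀ = 0
    · rcases (hmin n hn).eq_or_lt with rfl | hlt
      · filter_upwards [self_mem_nhdsWithin] with s hs
        rw [hS] at hs
        exact hs
      · obtain ⟨ε, hε, hball⟩ := hess n hn ⟨l, hlt, hl⟩
        filter_upwards [self_mem_nhdsWithin,
          nhdsWithin_le_nhds (eventually_mem_arcBall (hb := hb) h t₀ hε)] with s hs hs'
        refine hball _ hs' fun heq => ?_
        have h0 : curveFst a b hb l s = 0 := by
          rw [curveFst, heq]
          exact hl
        rw [hS, Set.mem_ofPred_eq, h0] at hs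
        cases hpl : p l
        · exact (hs.2 hpl).false
        · exact (hs.1 hpl).false
    · exact nhdsWithin_le_nhds (hne n hn)
  · push Not at hz
    exact ⟨𝓝 t₀, inferInstance, fun n => hne n (hz n)⟩

theorem essentialAdmissible_subset_of_coding_image_eq (h : Eigen a b m ν) {Ξ : Set (ℤ → Bool)}
    (hΞ : Ξ ⊆ admissible a b hb) (hc : IsCompact Ξ)
    (himg : coding a b hb '' Ξ = attractor a b hb) : essentialAdmissible a b hb ⊆ Ξ := by
  refine closure_minimal ?_ hc.isClosed
  intro p hp
  obtain ⟨𝓕, hbot, h𝓕⟩ := exists_filter_of_mem_essentialR h hp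
  have hex : ∀ s, ∃ ξ ∈ Ξ, IsItinerary a b hb (unstableCurve a b hb s) ξ := by
    intro s
    have hs := unstableCurve_mem_attractor (hb := hb) h s
    rw [← himg] at hs
    obtain ⟨ξ, hξ, heq⟩ := hs
    refine ⟨ξ, hξ, ?_⟩
    rw [← heq]
    exact (coding_spec (hΞ hξ)).2
  choose ξ hξΞ hξ using hex
  have hlim : Tendsto ξ 𝓕 (𝓝 p) := by
    rw [tendsto_pi_nhds]
    intro n
    refine tendsto_const_nhds.congr' ?_
    filter_upwards [h𝓕 n] with s hs
    cases hpn : p n <;> cases hsn : ξ s n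
    · rfl
    · exact absurd ((hξ s n).1 hsn) (not_le.2 (hs.2 hpn))
    · exact absurd ((hξ s n).2 hsn) (not_le.2 (hs.1 hpn))
    · rfl
  exact hc.isClosed.mem_of_tendsto hlim (Eventually.of_forall hξΞ)

end Lozi

end

theorem mainTheorem3 (a b : ℝ) (hb : 0 < b) (h₁ : b + 2 < a * √2)
    (h₂ : b < (a ^ 2 - 1) / (2 * a + 1)) (h₃ : 2 * a + b < 4) :
    (∀ p ∈ Lozi.admissible a b hb,
      ∃! P : ℝ × ℝ, P ∈ Lozi.attractor a b hb ∧ Lozi.IsItinerary a b hb P p) ∧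
    Lozi.essentialAdmissible a b hb ⊆ Lozi.admissible a b hb ∧
    Lozi.coding a b hb '' Lozi.essentialAdmissible a b hb = Lozi.attractor a b hb ∧
    ∀ Ξ : Set (ℤ → Bool), Ξ ⊆ Lozi.admissible a b hb → IsCompact Ξ →
      Lozi.coding a b hb '' Ξ = Lozi.attractor a b hb →
        Lozi.essentialAdmissible a b hb ⊆ Ξ := by
  obtain ⟨m, ν, h⟩ := Lozi.exists_eigen hb h₁ h₃
  refine ⟨?_, Lozi.essentialAdmissible_subset h, ?_, fun Ξ hΞ hc himg =>
    Lozi.essentialAdmissible_subset_of_coding_image_eq h hΞ hc himg⟩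
  · rintro p ⟨P, hP, hp⟩
    exact ⟨P, ⟨hP, hp⟩, fun Q hQ => hQ.2.unique h hQ.1 hP hp⟩
  · refine (Lozi.attractor_subset_coding_image h).antisymm' ?_
    rintro _ ⟨p, hp, rfl⟩
    exact (Lozi.coding_spec (Lozi.essentialAdmissible_subset h hp)).1
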